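/- Let $K$ be a compact Hausdorff space that is dispersed (scattered), i.e. contains no non-empty perfect subset, and let $X=C(K)$ be the Banach space of continuous complex-valued functions on $K$ with the supremum norm. Let $B$ be the open unit ball of $X$, let $\overline{B}^{**}$ be the closed unit ball of the bidual $X^{**}$, and let $H^\infty(B)$ be the Banach algebra of all bounded analytic functions $f:B\to\mathbb{C}$ with the supremum norm. Let $M$ be the spectrum of $H^\infty(B)$, i.e. the set of all non-zero multiplicative linear functionals $\tau:H^\infty(B)\to\mathbb{C}$, and let $\widehat f(\tau)=\tau(f)$ be the Gelfand transform of $f\in H^\infty(B)$. For $x^{**}\in\overline{B}^{**}$ let $$M_{x^{**}}=\{\tau\in M:\ \tau(x^*|_B)=x^{**}(x^*)\ \text{for all } x^*\in X^*\}$$ be the fiber of $M$ over $x^{**}$, and for $f\in H^\infty(B)$ let $Cl_B(f,x^{**})$ be the cluster set of $f$ at $x^{**}$, i.e. the set of all limits $\lim_\alpha f(x_\alpha)$ along nets $(x_\alpha)$ in $B$ that converge to $x^{**}$ in the weak-star topology of $X^{**}$. Then the cluster value theorem holds for $H^\infty(B)$ at every point of $\overline{B}^{**}$: $$Cl_B(f,x^{**})=\widehat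 f(M_{x^{**}})\qquad\text{for every } x^{**}\in\overline{B}^{**}\text{ and every } f\in H^\infty(B).$$ -/

import Mathlib

open Filter Topology BoundedContinuousFunction

noncomputable section

/-- A topological space is dispersed (scattered) if it contains no non-empty perfect subset. -/
def IsDispersed (K : Type*) [TopologicalSpace K] : Prop :=
  ∀ C : Set K, Perfect C → C = ∅

section ClusterValues

variable (X : Type*) [NormedAddCommGroup X] [NormedSpace ℂ X]

/-- The open unit ball `B` of `X`. -/
abbrev UnitBall : Set X := Metric.ball (0 : X) 1

/-- The algebra `H^∞(B)` of all bounded analytic functions on the open unit ball `B` of `X`, with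
the supremum norm. Analyticity on the open set `B` is complex Fréchet differentiability at every
point of `B`; as functions here live on `B` itself, it is expressed through an extension to `X`,
whose values off `B` play no role. -/
def HInf : Subalgebra ℂ (UnitBall X →ᵇ ℂ) where
  carrier := {f | ∃ F : X → ℂ, DifferentiableOn ℂ F (UnitBall X) ∧ ∀ x : UnitBall X, F x = f x}
  mul_mem' := by
    rintro f g ⟨F, hF, hFf⟩ ⟨G, hG, hGg⟩
    exact ⟨F * G, hF.mul hG, fun x => by simp [hFf, hGg]⟩
  add_mem' := by
    rintro f g ⟨F, hF, hFf⟩ ⟨G, hG, hGg⟩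
    exact ⟨F + G, hF.add hG, fun x => by simp [hFf, hGg]⟩
  algebraMap_mem' c := ⟨fun _ => c, differentiableOn_const c, fun _ => rfl⟩

variable {X}

/-- The restriction `x*|_B` of a bounded linear functional, as an element of `H^∞(B)`. -/
def restrictFun (φ : StrongDual ℂ X) : HInf X :=
  ⟨BoundedContinuousFunction.ofNormedAddCommGroup (fun x : UnitBall X => φ x) (by fun_prop) ‖φ‖
    (fun x => by
      have hx : ‖(x : X)‖ ≤ 1 := (mem_ball_zero_iff.mp x.2).le
      exact φ.le_of_opNorm_le_of_le le_rfl hx |>.trans (mul_one _).le),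
    φ, φ.differentiable.differentiableOn, fun _ => rfl⟩

variable (X) in
/-- The inclusion `X* ⊂ H^∞(B)`, `x* ↦ x*|_B`, as a bounded linear map. -/
def restrictDual : StrongDual ℂ X →L[ℂ] HInf X :=
  LinearMap.mkContinuous
    { toFun := restrictFun
      map_add' := fun _ _ => rfl
      map_smul' := fun _ _ => rfl } 1
    (fun φ => by
      rw [one_mul]
      refine BoundedContinuousFunction.norm_ofNormedAddCommGroup_le _ (norm_nonneg φ) (fun x => ?_)
      have hx : ‖(x : X)‖ ≤ 1 := (mem_ball_zero_iff.mp x.2).le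
      exact φ.le_of_opNorm_le_of_le le_rfl hx |>.trans (mul_one _).le)

/-- The projection `π(τ) = τ|_{X*}` from the spectrum of `H^∞(B)` to the bidual `X**`. -/
def spectrumProj (τ : WeakDual.characterSpace ℂ (HInf X)) :
    StrongDual ℂ (StrongDual ℂ X) :=
  (WeakDual.toStrongDual (τ : WeakDual ℂ (HInf X))).comp (restrictDual X)

/-- The fiber `M_{x**}(B) = π⁻¹(x**)` of the spectrum of `H^∞(B)` over `x**`. -/
def fiber (x : StrongDual ℂ (StrongDual ℂ X)) : Set (WeakDual.characterSpace ℂ (HInf X)) :=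
  spectrumProj ⁻¹' {x}

/-- The inclusion of `B` in the bidual `X**` with its weak-star topology. -/
def toWeakStarBidual (b : UnitBall X) : WeakDual ℂ (StrongDual ℂ X) :=
  StrongDual.toWeakDual (NormedSpace.inclusionInDoubleDual ℂ X b)

/-- The cluster set `Cl_B(f, x**)`: all limits of values of `f` along nets (here: proper filters)
in `B` that converge weak-star to `x**`. -/
def clusterSet (f : HInf X) (x : StrongDual ℂ (StrongDual ℂ X)) : Set ℂ :=
  {z | ∃ l : Filter (UnitBall X), l.NeBot ∧
    Tendsto toWeakStarBidual l (𝓝 (StrongDual.toWeakDual x)) ∧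
    Tendsto (f : UnitBall X →ᵇ ℂ) l (𝓝 z)}

end ClusterValues

end

/-! One inclusion is soft: limits along an ultrafilter refining a net form a character, and it lies
in the fiber over the weak-star limit of the net.

For the other, let `τ` lie over `x` and put `w t = x (evalDual t)`. On a dispersed `K` the point
evaluations span a dense subspace of the dual (`topologicalClosure_span_evalDual`), so on the ball
weak-star convergence is pointwise convergence on `K`. It suffices to find, for finite `T` and
positive `ε`, `δ`, a point `b` of the ball with `b t` within `ε` of `w t` on `T` and `f b` within
`δ` of `τ f`. If there were none, `f - τ f` would be bounded below on `pointNhd w ε T`, and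
`hasBezoutOn_of_bounded_below` would give a Bezout identity on the whole ball: `(f - τ f) g + ∑ (x s
- w s) h s = 1`. Applying `τ` yields `0 = 1`.

The identity is trivial on `pointNhd w ε T`, with `g` the reciprocal of `f - τ f`. The constraints
are then dropped one point `t` at a time. A bump function at `t` lets the value `x t` be replaced by
a free variable `ζ` without touching the other constraints, so a coefficient becomes a function of
`(ζ, x)` with `ζ` in the part of the disc near `w t`. The one-variable result `exists_localization`,
a Cauchy integral after a Cayley transform, extends it to all `x t` in the disc with an error `O(x t
- w t)`. Shrinking the bump and passing to a limit gives `exists_bddHolOn_approx_of_insert`; the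
resulting error in the Bezout identity is absorbed algebraically in `HasBezoutOn.of_insert`. -/

section BoundedHolomorphic

/-! ### Taylor estimates, limits, integrals and quotients of bounded holomorphic functions. -/

variable {X : Type*} [NormedAddCommGroup X] [NormedSpace ℂ X]

theorem norm_fderiv_le_of_bounded {f : X → ℂ} {x : X} {r M : ℝ} (hr : 0 < r)
    (hf : DifferentiableOn ℂ f (Metric.ball x r)) (hM : ∀ y ∈ Metric.ball x r, ‖f y‖ ≤ M) :
    ‖fderiv ℂ f x‖ ≤ 2 * M / r := by
  refine Complex.norm_fderiv_le_div_of_mapsTo_ball hf (fun y hy => ?_) hr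
  rw [mem_closedBall_iff_norm]
  have := hM y hy
  have := hM x (Metric.mem_ball_self hr)
  linarith [norm_sub_le (f y) (f x)]

/-- Second order Taylor estimate for a bounded holomorphic function on a ball. -/
theorem norm_sub_sub_fderiv_le_of_bounded {f : X → ℂ} {x v : X} {r M : ℝ} (hr : 0 < r)
    (hf : DifferentiableOn ℂ f (Metric.ball x r)) (hM : ∀ y ∈ Metric.ball x r, ‖f y‖ ≤ M)
    (hv : ‖v‖ < r) :
    ‖f (x + v) - f x - fderiv ℂ f x v‖ ≤ 4 * M / r ^ 2 * ‖v‖ ^ 2 := by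
  have hfx : DifferentiableAt ℂ f x :=
    hf.differentiableAt (Metric.isOpen_ball.mem_nhds (Metric.mem_ball_self hr))
  have hD := norm_fderiv_le_of_bounded hr hf hM
  have hxM := hM x (Metric.mem_ball_self hr)
  -- Higher-order Schwarz lemma for `f` minus its linear part; `4 * M` is `M + M` from the two
  -- values of `f` plus `2 * M` from the linear term.
  have key := Complex.dist_le_mul_div_pow_of_mapsTo_ball_of_isLittleO
    (f := fun y => f y - fderiv ℂ f x (y - x)) (c := x) (z := x + v) (R₁ := r) (R₂ := 4 * M)
    (n := 1) (hf.sub (by fun_prop)) (fun y hy => ?_) ?_ (by simpa using hv)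
  · have e : dist (f (x + v) - fderiv ℂ f x (x + v - x)) (f x - fderiv ℂ f x (x - x)) =
        ‖f (x + v) - f x - fderiv ℂ f x v‖ := by
      rw [dist_eq_norm]; congr 1; simp; ring
    rw [e] at key
    refine key.trans_eq ?_
    rw [dist_eq_norm]; simp; ring
  · rw [mem_closedBall_iff_norm]
    have h1 := hM y hy
    have hy' : ‖y - x‖ < r := mem_ball_iff_norm.mp hy
    have h2 : ‖fderiv ℂ f x (y - x)‖ ≤ 2 * M := by
      calc _ ≤ ‖fderiv ℂ f x‖ * ‖y - x‖ := (fderiv ℂ f x).le_opNorm _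
        _ ≤ 2 * M / r * r := by gcongr; exact (norm_nonneg _).trans hD
        _ = 2 * M := by field_simp
    calc _ = ‖f y - f x - fderiv ℂ f x (y - x)‖ := by congr 1; simp; ring
      _ ≤ ‖f y‖ + ‖f x‖ + ‖fderiv ℂ f x (y - x)‖ :=
        (norm_sub_le _ _).trans (by gcongr; exact norm_sub_le _ _)
      _ ≤ 4 * M := by linarith
  · have := hfx.hasFDerivAt.isLittleO
    simp only [pow_one]
    refine (this.norm_right).congr_left fun y => ?_
    simp; ring

theorem differentiableAt_of_norm_sub_sub_le {f : X → ℂ} {x : X} (L : X →L[ℂ] ℂ) {r C : ℝ}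
    (hr : 0 < r) (h : ∀ v, ‖v‖ < r → ‖f (x + v) - f x - L v‖ ≤ C * ‖v‖ ^ 2) :
    DifferentiableAt ℂ f x := by
  refine HasFDerivAt.differentiableAt (f' := L) ?_
  rw [hasFDerivAt_iff_isLittleO_nhds_zero]
  have : (fun v => f (x + v) - f x - L v) =O[𝓝 0] fun v => ‖v‖ ^ 2 := by
    refine Asymptotics.IsBigO.of_bound C ?_
    filter_upwards [Metric.ball_mem_nhds 0 hr] with v hv
    simpa using h v (by simpa using hv)
  exact this.trans_isLittleO (Asymptotics.isLittleO_norm_pow_id one_lt_two)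

theorem Ultrafilter.exists_tendsto_of_norm_le {ι : Type*} (𝒰 : Ultrafilter ι) {a : ι → ℂ} {M : ℝ}
    (h : ∀ᶠ i in 𝒰, ‖a i‖ ≤ M) : ∃ z, ‖z‖ ≤ M ∧ Tendsto a 𝒰 (𝓝 z) := by
  obtain ⟨z, hz, hle⟩ := (isCompact_closedBall (0 : ℂ) M).ultrafilter_le_nhds (𝒰.map a)
    (le_principal_iff.mpr (h.mono fun i hi => by simpa using hi))
  exact ⟨z, by simpa using hz, hle⟩

/-- A normal family argument: a uniformly bounded family of holomorphic functions has a holomorphic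
pointwise limit along an ultrafilter. -/
theorem exists_ultrafilter_tendsto_differentiableOn {ι : Type*} (l : Filter ι) [l.NeBot] {V : Set X}
    (hV : IsOpen V) {F : ι → X → ℂ} {M : ℝ}
    (hF : ∀ᶠ i in l, DifferentiableOn ℂ (F i) V ∧ ∀ x ∈ V, ‖F i x‖ ≤ M) :
    ∃ (𝒰 : Ultrafilter ι) (H : X → ℂ), ↑𝒰 ≤ l ∧ DifferentiableOn ℂ H V ∧
      (∀ x ∈ V, ‖H x‖ ≤ M) ∧ ∀ x ∈ V, Tendsto (fun i => F i x) 𝒰 (𝓝 (H x)) := by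
  let 𝒰 := Ultrafilter.of l
  have h𝒰 : ∀ᶠ i in (𝒰 : Filter ι), DifferentiableOn ℂ (F i) V ∧ ∀ x ∈ V, ‖F i x‖ ≤ M :=
    Ultrafilter.of_le l hF
  have hlim : ∀ x, ∃ z, x ∈ V → ‖z‖ ≤ M ∧ Tendsto (fun i => F i x) 𝒰 (𝓝 z) := fun x => by
    by_cases hx : x ∈ V
    · obtain ⟨z, hz⟩ := 𝒰.exists_tendsto_of_norm_le (h𝒰.mono fun i hi => hi.2 x hx)
      exact ⟨z, fun _ => hz⟩
    · exact ⟨0, fun h => absurd h hx⟩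
  choose H hH using hlim
  refine ⟨𝒰, H, Ultrafilter.of_le l, fun x hx => ?_, fun x hx => (hH x hx).1,
    fun x hx => (hH x hx).2⟩
  obtain ⟨r, hr, hrV⟩ := Metric.isOpen_iff.mp hV x hx
  have hDb : ∀ v, ∀ᶠ i in (𝒰 : Filter ι), ‖fderiv ℂ (F i) x v‖ ≤ 2 * M / r * ‖v‖ := fun v => by
    filter_upwards [h𝒰] with i hi
    exact (fderiv ℂ (F i) x).le_of_opNorm_le
      (norm_fderiv_le_of_bounded hr (hi.1.mono hrV) fun y hy => hi.2 y (hrV hy)) v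
  -- The derivative of the limit is the limit of the derivatives, direction by direction; the
  -- second-order Taylor bound is uniform in `i` and so survives the limit.
  choose D hDle hD using fun v => 𝒰.exists_tendsto_of_norm_le (hDb v)
  let L : X →L[ℂ] ℂ := LinearMap.mkContinuous
    { toFun := D
      map_add' := fun v w => tendsto_nhds_unique (hD (v + w))
        (((hD v).add (hD w)).congr fun i => (map_add _ _ _).symm)
      map_smul' := fun c v => tendsto_nhds_unique (hD (c • v))
        (((hD v).const_smul c).congr fun i => (map_smul _ _ _).symm) } (2 * M / r) hDle
  refine (differentiableAt_of_norm_sub_sub_le L hr (C := 4 * M / r ^ 2)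
    fun v hv => ?_).differentiableWithinAt
  have hxv : x + v ∈ V := hrV (by simpa using hv)
  refine le_of_tendsto (((hH _ hxv).2.sub (hH x hx).2).sub (hD v)).norm ?_
  filter_upwards [h𝒰] with i hi
  exact norm_sub_sub_fderiv_le_of_bounded hr (hi.1.mono hrV) (fun y hy => hi.2 y (hrV hy)) hv

/-- The uniform Taylor estimate can be integrated over `u`. Continuity in `u` is needed only for the
values: directional derivatives inherit it as uniform limits of difference quotients. -/
theorem differentiableOn_intervalIntegral {V : Set X} (hV : IsOpen V) {F : ℝ → X → ℂ} {a b : ℝ}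
    (hF : ∀ u ∈ Set.uIcc a b, DifferentiableOn ℂ (F u) V)
    (hb : ∀ x ∈ V, ∃ r > 0, ∃ M, ∀ u ∈ Set.uIcc a b, ∀ y ∈ Metric.ball x r, ‖F u y‖ ≤ M)
    (hc : ∀ x ∈ V, ContinuousOn (fun u => F u x) (Set.uIcc a b)) :
    DifferentiableOn ℂ (fun x => ∫ u in a..b, F u x) V := by
  intro x hx
  obtain ⟨r₁, hr₁, M, hM⟩ := hb x hx
  obtain ⟨r₂, hr₂, hrV⟩ := Metric.isOpen_iff.mp hV x hx
  obtain ⟨r, hr, h1, h2⟩ : ∃ r > 0, r ≤ r₁ ∧ r ≤ r₂ :=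
    ⟨min r₁ r₂, lt_min hr₁ hr₂, min_le_left _ _, min_le_right _ _⟩
  replace hrV : Metric.ball x r ⊆ V := (Metric.ball_subset_ball h2).trans hrV
  replace hM : ∀ u ∈ Set.uIcc a b, ∀ y ∈ Metric.ball x r, ‖F u y‖ ≤ M :=
    fun u hu y hy => hM u hu y (Metric.ball_subset_ball h1 hy)
  have hT : ∀ u ∈ Set.uIcc a b, ∀ v, ‖v‖ < r →
      ‖F u (x + v) - F u x - fderiv ℂ (F u) x v‖ ≤ 4 * M / r ^ 2 * ‖v‖ ^ 2 := fun u hu v hv =>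
    norm_sub_sub_fderiv_le_of_bounded hr ((hF u hu).mono hrV) (hM u hu) hv
  have hDc : ∀ v, ContinuousOn (fun u => fderiv ℂ (F u) x v) (Set.uIcc a b) := fun v => by
    have hs : ∀ᶠ c : ℂ in 𝓝[≠] 0, ‖c • v‖ < r := by
      have : Tendsto (fun c : ℂ => ‖c • v‖) (𝓝[≠] 0) (𝓝 0) := by
        have h : Continuous fun c : ℂ => ‖c • v‖ := by fun_prop
        simpa using (h.tendsto 0).mono_left nhdsWithin_le_nhds
      exact this.eventually_lt_const hr
    have hu : TendstoUniformlyOn (fun (c : ℂ) u => c⁻¹ * (F u (x + c • v) - F u x))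
        (fun u => fderiv ℂ (F u) x v) (𝓝[≠] 0) (Set.uIcc a b) := by
      rw [Metric.tendstoUniformlyOn_iff]
      intro ε hε
      have h0 : Tendsto (fun c : ℂ => ‖c‖ * (4 * M / r ^ 2 * ‖v‖ ^ 2)) (𝓝[≠] 0) (𝓝 0) := by
        have h : Continuous fun c : ℂ => ‖c‖ * (4 * M / r ^ 2 * ‖v‖ ^ 2) := by fun_prop
        simpa using (h.tendsto 0).mono_left nhdsWithin_le_nhds
      filter_upwards [hs, h0.eventually_lt_const hε, self_mem_nhdsWithin] with c hc hcε hc0 u hu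
      have hc0 : c ≠ 0 := hc0
      refine lt_of_le_of_lt ?_ hcε
      rw [dist_comm, dist_eq_norm]
      have e : c⁻¹ * (F u (x + c • v) - F u x) - fderiv ℂ (F u) x v =
          c⁻¹ * (F u (x + c • v) - F u x - fderiv ℂ (F u) x (c • v)) := by
        rw [map_smul, smul_eq_mul]; field_simp
      have hcn : 0 < ‖c‖ := norm_pos_iff.mpr hc0
      rw [e, norm_mul, norm_inv]
      calc _ ≤ ‖c‖⁻¹ * (4 * M / r ^ 2 * ‖c • v‖ ^ 2) := by gcongr; exact hT u hu _ hc
        _ = _ := by rw [norm_smul]; field_simp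
    refine hu.continuousOn (Eventually.frequently ?_)
    filter_upwards [hs] with c hcv
    exact continuousOn_const.mul ((hc _ (hrV (by simpa using hcv))).sub (hc x hx))
  have hDi := fun v => (hDc v).intervalIntegrable (μ := MeasureTheory.volume)
  have hFi := fun y hy => (hc y hy).intervalIntegrable (μ := MeasureTheory.volume)
  let L : X →L[ℂ] ℂ := LinearMap.mkContinuous
    { toFun := fun v => ∫ u in a..b, fderiv ℂ (F u) x v
      map_add' := fun v w => by
        simp only [map_add]
        exact intervalIntegral.integral_add (hDi v) (hDi w)
      map_smul' := fun c v => by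
        simp only [map_smul, RingHom.id_apply]
        exact intervalIntegral.integral_smul c _ } (2 * M / r * |b - a|) (fun v => by
      refine (intervalIntegral.norm_integral_le_of_norm_le_const (C := 2 * M / r * ‖v‖)
        fun u hu => ?_).trans_eq (by ring)
      have hu := Set.uIoc_subset_uIcc hu
      exact (fderiv ℂ (F u) x).le_of_opNorm_le
        (norm_fderiv_le_of_bounded hr ((hF u hu).mono hrV) (hM u hu)) v)
  refine (differentiableAt_of_norm_sub_sub_le L hr (C := 4 * M / r ^ 2 * |b - a|)
    fun v hv => ?_).differentiableWithinAt
  have hxv : x + v ∈ V := hrV (by simpa using hv)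
  change ‖(∫ u in a..b, F u (x + v)) - (∫ u in a..b, F u x) - ∫ u in a..b, fderiv ℂ (F u) x v‖ ≤ _
  rw [← intervalIntegral.integral_sub (hFi _ hxv) (hFi x hx),
    ← intervalIntegral.integral_sub ((hFi _ hxv).sub (hFi x hx)) (hDi v)]
  refine (intervalIntegral.norm_integral_le_of_norm_le_const (C := 4 * M / r ^ 2 * ‖v‖ ^ 2)
    fun u hu => hT u (Set.uIoc_subset_uIcc hu) v hv).trans_eq (by ring)

theorem norm_pow_three_div_le {e a : ℂ} {C : ℝ} (h : ‖e‖ ≤ C * ‖a‖) :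
    ‖e ^ 3 / a‖ ≤ C ^ 3 * ‖a‖ ^ 2 := by
  by_cases ha : a = 0
  · simp [ha]
  have ha' : 0 < ‖a‖ := norm_pos_iff.mpr ha
  rw [norm_div, norm_pow, div_le_iff₀ ha']
  calc ‖e‖ ^ 3 ≤ (C * ‖a‖) ^ 3 := by gcongr
    _ = _ := by ring

/-- If `e` is bounded holomorphic and dominated by `a`, then `e³` is divisible by `a`. -/
theorem differentiableOn_pow_three_div {V : Set X} (hV : IsOpen V) {e a : X → ℂ} {C : ℝ}
    (he : DifferentiableOn ℂ e V) (ha : DifferentiableOn ℂ a V)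
    (h : ∀ x ∈ V, ‖e x‖ ≤ C * ‖a x‖) : DifferentiableOn ℂ (fun x => e x ^ 3 / a x) V := by
  intro x hx
  have hV' := hV.mem_nhds hx
  by_cases hax : a x = 0
  · have hex : e x = 0 := norm_le_zero_iff.mp (by simpa [hax] using h x hx)
    refine HasFDerivAt.differentiableAt (f' := 0) ?_ |>.differentiableWithinAt
    -- At a zero of `a` the cube makes the quotient `O(‖a‖ ^ 2)`, hence `o(‖y - x‖)`, so its
    -- derivative there is `0`. The value `0 / 0 = 0` is the right one.
    rw [hasFDerivAt_iff_isLittleO]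
    have hO : a =O[𝓝 x] fun y => y - x := by
      simpa [hax] using (ha.differentiableAt hV').isBigO_sub
    have : (fun y => e y ^ 3 / a y) =O[𝓝 x] fun y => a y ^ 2 := by
      refine Asymptotics.IsBigO.of_bound (C ^ 3) ?_
      filter_upwards [hV'] with y hy
      simpa using norm_pow_three_div_le (h y hy)
    have := (this.trans (hO.norm_right.pow 2)).trans_isLittleO
      (Asymptotics.isLittleO_pow_sub_sub x one_lt_two)
    simpa [hax] using this
  · simp only [div_eq_mul_inv]
    exact (((he.differentiableAt hV').fun_pow 3).fun_mul
      ((ha.differentiableAt hV').fun_inv hax)).differentiableWithinAt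

end BoundedHolomorphic

/-! ### Cauchy integrals over a square resting on the real axis. -/

section SquareLocalization

open Complex

theorem integral_mul_inv_eq_log_sub_log {a b : ℝ} {c d : ℂ}
    (h : ∀ t ∈ Set.uIcc a b, c + t * d ∈ slitPlane) :
    ∫ t : ℝ in a..b, d * (c + t * d)⁻¹ = log (c + b * d) - log (c + a * d) := by
  refine intervalIntegral.integral_eq_sub_of_hasDerivAt (f := fun t : ℝ => log (c + t * d))
    (fun t ht => ?_) (ContinuousOn.intervalIntegrable ?_)
  · have h1 : HasDerivAt (fun t : ℝ => c + (t : ℂ) * d) d t := by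
      simpa using ((hasDerivAt_id t).ofReal_comp.mul_const d).const_add c
    simpa [div_eq_mul_inv] using h1.clog_real (h t ht)
  · exact continuousOn_const.mul (ContinuousOn.inv₀ (by fun_prop)
      fun t ht => slitPlane_ne_zero (h t ht))

/-- The closed square with vertices `-1`, `1`, `1 + 2i`, `-1 + 2i`. -/
def baseSquare : Set ℂ := Set.Icc (-1) 1 ×ℂ Set.Icc 0 2

/-- Integral over the three sides of `baseSquare` off the real axis, oriented from `-1` to `1`. -/
noncomputable def upperSidesIntegral (f : ℂ → ℂ) : ℂ :=
  (∫ t : ℝ in (-1)..1, f (t + 2 * I)) - I * (∫ y : ℝ in (0)..2, f (1 + y * I)) +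
    I * ∫ y : ℝ in (0)..2, f (-1 + y * I)

/-- The three sides of `baseSquare` off the real axis. -/
def upperSides : Set ℂ :=
  {ζ ∈ baseSquare | ζ.im = 2 ∨ ζ.re = 1 ∨ ζ.re = -1}

theorem top_mem_upperSides {t : ℝ} (ht : t ∈ Set.uIcc (-1 : ℝ) 1) :
    (t + 2 * I : ℂ) ∈ upperSides := by
  rw [Set.uIcc_of_le (by norm_num)] at ht
  simp [upperSides, baseSquare, mem_reProdIm, ht.1, ht.2]

theorem right_mem_upperSides {y : ℝ} (hy : y ∈ Set.uIcc (0 : ℝ) 2) :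
    (1 + y * I : ℂ) ∈ upperSides := by
  rw [Set.uIcc_of_le (by norm_num)] at hy
  simp [upperSides, baseSquare, mem_reProdIm, hy.1, hy.2]

theorem left_mem_upperSides {y : ℝ} (hy : y ∈ Set.uIcc (0 : ℝ) 2) :
    (-1 + y * I : ℂ) ∈ upperSides := by
  rw [Set.uIcc_of_le (by norm_num)] at hy
  simp [upperSides, baseSquare, mem_reProdIm, hy.1, hy.2]

theorem norm_upperSidesIntegral_le {f : ℂ → ℂ} {C : ℝ} (h : ∀ ζ ∈ upperSides, ‖f ζ‖ ≤ C) :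
    ‖upperSidesIntegral f‖ ≤ 6 * C := by
  have h1 := intervalIntegral.norm_integral_le_of_norm_le_const (a := -1) (b := 1)
    (f := fun t : ℝ => f (t + 2 * I))
    fun t ht => h _ (top_mem_upperSides (Set.uIoc_subset_uIcc ht))
  have h2 := intervalIntegral.norm_integral_le_of_norm_le_const (a := 0) (b := 2)
    (f := fun y : ℝ => f (1 + y * I))
    fun t ht => h _ (right_mem_upperSides (Set.uIoc_subset_uIcc ht))
  have h3 := intervalIntegral.norm_integral_le_of_norm_le_const (a := 0) (b := 2)
    (f := fun y : ℝ => f (-1 + y * I))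
    fun t ht => h _ (left_mem_upperSides (Set.uIoc_subset_uIcc ht))
  norm_num at h1 h2 h3
  unfold upperSidesIntegral
  refine (norm_add_le _ _).trans ?_
  have := norm_sub_le (∫ t : ℝ in (-1)..1, f (t + 2 * I)) (I * (∫ y : ℝ in (0)..2, f (1 + y * I)))
  rw [norm_mul, norm_I, one_mul] at *
  linarith

theorem upperSidesIntegral_sub {f g : ℂ → ℂ} (hf : ContinuousOn f upperSides)
    (hg : ContinuousOn g upperSides) :
    upperSidesIntegral (fun ζ => f ζ - g ζ) = upperSidesIntegral f - upperSidesIntegral g := by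
  have h1 : ∀ {f : ℂ → ℂ}, ContinuousOn f upperSides → IntervalIntegrable
      (fun t : ℝ => f (t + 2 * I)) MeasureTheory.volume (-1) 1 := fun hf =>
    (hf.comp (by fun_prop) fun t ht => top_mem_upperSides ht).intervalIntegrable
  have h2 : ∀ {f : ℂ → ℂ}, ContinuousOn f upperSides → IntervalIntegrable
      (fun y : ℝ => f (1 + y * I)) MeasureTheory.volume 0 2 := fun hf =>
    (hf.comp (by fun_prop) fun t ht => right_mem_upperSides ht).intervalIntegrable
  have h3 : ∀ {f : ℂ → ℂ}, ContinuousOn f upperSides → IntervalIntegrable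
      (fun y : ℝ => f (-1 + y * I)) MeasureTheory.volume 0 2 := fun hf =>
    (hf.comp (by fun_prop) fun t ht => left_mem_upperSides ht).intervalIntegrable
  unfold upperSidesIntegral
  rw [intervalIntegral.integral_sub (h1 hf) (h1 hg), intervalIntegral.integral_sub (h2 hf) (h2 hg),
    intervalIntegral.integral_sub (h3 hf) (h3 hg)]
  ring

theorem log_sub_log_neg_of_im_pos {z : ℂ} (hz : 0 < z.im) : log z - log (-z) = Real.pi * I := by
  apply Complex.ext
  · simp [log_re]
  · simp [log_im, arg_neg_eq_arg_sub_pi_of_im_pos hz]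

/-- On each side the integrand has a primitive built from the principal logarithm. The left side
meets the branch cut, so there the argument is negated; the two changes of branch contribute `π i`
each. -/
theorem integral_inv_sub_baseSquare {z : ℂ} (h1 : -1 < z.re) (h2 : z.re < 1) (h3 : 0 < z.im)
    (h4 : z.im < 2) :
    (∫ t : ℝ in (-1)..1, ((t : ℂ) - z)⁻¹) - upperSidesIntegral (fun ζ => (ζ - z)⁻¹) =
      2 * Real.pi * I := by
  have e1 := integral_mul_inv_eq_log_sub_log (a := -1) (b := 1) (c := -z) (d := 1) fun t ht => by
    rw [mem_slitPlane_iff]; right; simpa using h3.ne'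
  have e2 := integral_mul_inv_eq_log_sub_log (a := -1) (b := 1) (c := 2 * I - z) (d := 1)
    fun t ht => by rw [mem_slitPlane_iff]; right; simp; linarith
  have e3 := integral_mul_inv_eq_log_sub_log (a := 0) (b := 2) (c := 1 - z) (d := I)
    fun t ht => by rw [mem_slitPlane_iff]; left; simpa using h2
  have e4 := integral_mul_inv_eq_log_sub_log (a := 0) (b := 2) (c := 1 + z) (d := -I)
    fun t ht => by rw [mem_slitPlane_iff]; left; simp; linarith
  have l1 := log_sub_log_neg_of_im_pos (z := 1 + z) (by simpa using h3)
  have l2 := log_sub_log_neg_of_im_pos (z := -1 + 2 * I - z) (by simp; linarith)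
  have r1 : ∫ t : ℝ in (-1)..1, ((t : ℂ) - z)⁻¹ = log (1 - z) - log (-(1 + z)) := by
    rw [show (1 - z : ℂ) = -z + (1 : ℝ) * 1 by push_cast; ring,
      show (-(1 + z) : ℂ) = -z + (-1 : ℝ) * 1 by push_cast; ring, ← e1]
    congr 1; ext t; rw [one_mul]; congr 1; ring
  have r2 : ∫ t : ℝ in (-1)..1, ((t : ℂ) + 2 * I - z)⁻¹ =
      log (1 + 2 * I - z) - log (-1 + 2 * I - z) := by
    rw [show (1 + 2 * I - z : ℂ) = 2 * I - z + (1 : ℝ) * 1 by push_cast; ring,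
      show (-1 + 2 * I - z : ℂ) = 2 * I - z + (-1 : ℝ) * 1 by push_cast; ring, ← e2]
    congr 1; ext t; rw [one_mul]; congr 1; ring
  have r3 : I * ∫ y : ℝ in (0)..2, ((1 : ℂ) + y * I - z)⁻¹ =
      log (1 + 2 * I - z) - log (1 - z) := by
    rw [show (1 + 2 * I - z : ℂ) = 1 - z + (2 : ℝ) * I by push_cast; ring]
    nth_rw 2 [show (1 - z : ℂ) = 1 - z + (0 : ℝ) * I by push_cast; ring]
    rw [← e3, ← intervalIntegral.integral_const_mul]
    congr 1; ext t; congr 2; ring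
  have r4 : I * ∫ y : ℝ in (0)..2, ((-1 : ℂ) + y * I - z)⁻¹ =
      log (-(-1 + 2 * I - z)) - log (1 + z) := by
    rw [show (-(-1 + 2 * I - z) : ℂ) = 1 + z + (2 : ℝ) * -I by push_cast; ring]
    nth_rw 2 [show (1 + z : ℂ) = 1 + z + (0 : ℝ) * -I by push_cast; ring]
    rw [← e4, ← intervalIntegral.integral_const_mul]
    congr 1; ext t
    rw [show (1 + z + t * -I : ℂ) = -(-1 + t * I - z) by ring, inv_neg]; ring
  unfold upperSidesIntegral
  rw [r1, r2, r3, r4]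
  linear_combination l1 + l2

theorem upperSidesIntegral_congr {f g : ℂ → ℂ} (h : Set.EqOn f g upperSides) :
    upperSidesIntegral f = upperSidesIntegral g := by
  unfold upperSidesIntegral
  rw [intervalIntegral.integral_congr fun t ht => h (top_mem_upperSides ht),
    intervalIntegral.integral_congr fun t ht => h (right_mem_upperSides ht),
    intervalIntegral.integral_congr fun t ht => h (left_mem_upperSides ht)]

theorem upperSidesIntegral_const_mul (c : ℂ) (f : ℂ → ℂ) :
    upperSidesIntegral (fun ζ => c * f ζ) = c * upperSidesIntegral f := by
  unfold upperSidesIntegral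
  simp only [intervalIntegral.integral_const_mul]
  ring

theorem ofReal_mem_baseSquare {t : ℝ} (ht : t ∈ Set.uIcc (-1 : ℝ) 1) : (t : ℂ) ∈ baseSquare := by
  rw [Set.uIcc_of_le (by norm_num)] at ht
  simp [baseSquare, mem_reProdIm, ht.1, ht.2]

theorem upperSides_subset_baseSquare : upperSides ⊆ baseSquare := fun _ h => h.1

/-- The Cauchy integral formula for `baseSquare`. -/
theorem integral_div_sub_baseSquare {f : ℂ → ℂ} (hf : DifferentiableOn ℂ f baseSquare) {z : ℂ}
    (h1 : -1 < z.re) (h2 : z.re < 1) (h3 : 0 < z.im) (h4 : z.im < 2) :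
    (∫ t : ℝ in (-1)..1, f t / (t - z)) - upperSidesIntegral (fun ζ => f ζ / (ζ - z)) =
      2 * Real.pi * I * f z := by
  have hint : ∀ ζ ∈ Set.Ioo (-1 : ℝ) 1 ×ℂ Set.Ioo (0 : ℝ) 2, baseSquare ∈ 𝓝 ζ := fun ζ hζ =>
    mem_of_superset ((isOpen_Ioo.reProdIm isOpen_Ioo).mem_nhds hζ)
      (Set.inter_subset_inter (Set.preimage_mono Set.Ioo_subset_Icc_self)
        (Set.preimage_mono Set.Ioo_subset_Icc_self))
  have hz : baseSquare ∈ 𝓝 z := hint z ⟨⟨h1, h2⟩, ⟨h3, h4⟩⟩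
  have hne : ∀ ζ ∈ upperSides, ζ - z ≠ 0 := by
    rintro ζ ⟨-, h⟩ h0
    rw [sub_eq_zero.mp h0] at h
    rcases h with h | h | h <;> linarith
  have hne' : ∀ t : ℝ, (t : ℂ) - z ≠ 0 := fun t h0 => by
    have := congrArg im h0
    simp at this
    linarith
  have hrect := integral_boundary_rect_eq_zero_of_differentiable_on_off_countable (dslope f z)
    (-1) (1 + 2 * I) {z} (Set.countable_singleton z)
    (by
      have : Set.uIcc (-1 : ℂ).re (1 + 2 * I : ℂ).re ×ℂ Set.uIcc (-1 : ℂ).im (1 + 2 * I : ℂ).im =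
          baseSquare := by simp [baseSquare]
      rw [this, continuousOn_dslope hz]
      exact ⟨hf.continuousOn, hf.differentiableAt hz⟩)
    (by
      rintro ζ ⟨hζ, hζz⟩
      rw [differentiableAt_dslope_of_ne (by simpa using hζz)]
      exact hf.differentiableAt (hint ζ (by simpa using hζ)))
  have hrect' : (∫ t : ℝ in (-1)..1, dslope f z t) - upperSidesIntegral (dslope f z) = 0 := by
    rw [← hrect, upperSidesIntegral]
    simp
    ring
  have hds : ∀ ζ, ζ - z ≠ 0 → dslope f z ζ = f ζ / (ζ - z) - f z * (ζ - z)⁻¹ := fun ζ h => by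
    rw [dslope_of_ne _ (sub_ne_zero.mp h), slope_def_field, sub_div, div_eq_mul_inv (f z)]
  have hfc := hf.continuousOn
  have hcont : ContinuousOn (fun ζ => f ζ / (ζ - z)) upperSides :=
    (hfc.mono upperSides_subset_baseSquare).div (by fun_prop) hne
  have hcont' : ContinuousOn (fun ζ => f z * (ζ - z)⁻¹) upperSides :=
    continuousOn_const.mul (ContinuousOn.inv₀ (by fun_prop) hne)
  have hi : IntervalIntegrable (fun t : ℝ => f t / (t - z)) MeasureTheory.volume (-1) 1 :=
    ContinuousOn.intervalIntegrable
      ((hfc.comp (by fun_prop) fun t ht => ofReal_mem_baseSquare ht).div (by fun_prop)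
        fun t _ => hne' t)
  have hi' : IntervalIntegrable (fun t : ℝ => f z * ((t : ℂ) - z)⁻¹) MeasureTheory.volume (-1) 1 :=
    Continuous.intervalIntegrable
      (continuous_const.mul (Continuous.inv₀ (by fun_prop) hne')) _ _
  rw [upperSidesIntegral_congr fun ζ hζ => hds ζ (hne ζ hζ), upperSidesIntegral_sub hcont hcont',
    upperSidesIntegral_const_mul,
    intervalIntegral.integral_congr fun t _ => hds t (hne' t),
    intervalIntegral.integral_sub hi hi', intervalIntegral.integral_const_mul] at hrect'
  linear_combination hrect' + f z * integral_inv_sub_baseSquare h1 h2 h3 h4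

/-- A linear operator that extends a holomorphic function on `baseSquare` to the upper half plane,
up to an error that vanishes at `0`. -/
noncomputable def squareLocalize (p : ℂ → ℂ) (z : ℂ) : ℂ :=
  (2 * Real.pi * I)⁻¹ * ((∫ t : ℝ in (-1)..1, (1 - (t : ℂ) ^ 2) * p t / (t - z)) -
    upperSidesIntegral fun ζ => (1 - ζ ^ 2) * p ζ / ζ)

theorem norm_one_sub_sq_le {ζ : ℂ} (h : ζ ∈ baseSquare) : ‖1 - ζ ^ 2‖ ≤ 6 := by
  obtain ⟨⟨h1, h2⟩, ⟨h3, h4⟩⟩ := h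
  have : ‖ζ‖ ^ 2 ≤ 5 := by
    rw [Complex.sq_norm, normSq_apply]; nlinarith
  calc _ ≤ ‖(1 : ℂ)‖ + ‖ζ ^ 2‖ := norm_sub_le _ _
    _ ≤ 6 := by rw [norm_pow, norm_one]; linarith

theorem one_le_norm_of_mem_upperSides {ζ : ℂ} (h : ζ ∈ upperSides) : 1 ≤ ‖ζ‖ := by
  rcases h.2 with h | h | h
  · exact le_trans (by rw [h]; norm_num) (abs_im_le_norm ζ)
  · exact le_trans (by rw [h]; norm_num) (abs_re_le_norm ζ)
  · exact le_trans (by rw [h]; norm_num) (abs_re_le_norm ζ)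

theorem norm_two_pi_I_inv_le : ‖(2 * Real.pi * I : ℂ)⁻¹‖ ≤ 1 := by
  rw [norm_inv]
  refine inv_le_one_of_one_le₀ ?_
  simp [abs_of_pos Real.pi_pos]
  linarith [Real.pi_gt_three]

/-- Cauchy's formula inside the square. The real side alone makes sense on the whole half plane;
subtracting the other sides' contribution at `0` makes the correction vanish at `z = 0`. -/
theorem squareLocalize_eq {p : ℂ → ℂ} (hp : DifferentiableOn ℂ p baseSquare) {z : ℂ}
    (h1 : -1 < z.re) (h2 : z.re < 1) (h3 : 0 < z.im) (h4 : z.im < 2) :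
    squareLocalize p z = (1 - z ^ 2) * p z + (2 * Real.pi * I)⁻¹ *
      ((upperSidesIntegral fun ζ => (1 - ζ ^ 2) * p ζ / (ζ - z)) -
        upperSidesIntegral fun ζ => (1 - ζ ^ 2) * p ζ / ζ) := by
  have hC := integral_div_sub_baseSquare (f := fun ζ => (1 - ζ ^ 2) * p ζ)
    (DifferentiableOn.mul (by fun_prop) hp) h1 h2 h3 h4
  have hpi : (2 * Real.pi * I : ℂ) ≠ 0 := two_pi_I_ne_zero
  rw [squareLocalize]
  have := sub_eq_iff_eq_add.mp hC
  rw [this]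
  field_simp
  ring

theorem norm_upperSidesIntegral_div_le {p : ℂ → ℂ} {M : ℝ} (hM : ∀ ζ ∈ baseSquare, ‖p ζ‖ ≤ M) :
    ‖upperSidesIntegral fun ζ => (1 - ζ ^ 2) * p ζ / ζ‖ ≤ 36 * M := by
  refine (norm_upperSidesIntegral_le (C := 6 * M) fun ζ hζ => ?_).trans_eq (by ring)
  have hζ' := upperSides_subset_baseSquare hζ
  have h1 := one_le_norm_of_mem_upperSides hζ
  rw [norm_div, norm_mul, div_le_iff₀ (by linarith)]
  have := hM ζ hζ'
  have hM0 : 0 ≤ M := (norm_nonneg _).trans this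
  calc _ ≤ 6 * M * 1 := by rw [mul_one]; gcongr; exact norm_one_sub_sq_le hζ'
    _ ≤ _ := by gcongr

/-- The half plane is split by the triangle `z.im < 1 - |z.re|`. Outside it the integral over the
real side is bounded directly, inside it the form given by Cauchy's formula is used. In both cases
the weight `1 - ζ ^ 2`, which vanishes at the corners `±1`, dominates the singularity of the Cauchy
kernel. -/
theorem norm_squareLocalize_le {p : ℂ → ℂ} {M : ℝ} {z : ℂ}
    (hp : DifferentiableOn ℂ p baseSquare) (hM : ∀ ζ ∈ baseSquare, ‖p ζ‖ ≤ M)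
    (hz : 0 < z.im) : ‖squareLocalize p z‖ ≤ 100 * M := by
  have hM0 : 0 ≤ M := (norm_nonneg _).trans (hM 0 (by simp [baseSquare, mem_reProdIm]))
  have hN := norm_upperSidesIntegral_div_le hM
  have hpi := norm_two_pi_I_inv_le
  rcases le_or_gt (1 - |z.re|) z.im with h | h
  · have hI : ‖∫ t : ℝ in (-1)..1, (1 - (t : ℂ) ^ 2) * p t / (t - z)‖ ≤ 4 * M * |1 - (-1)| := by
      refine intervalIntegral.norm_integral_le_of_norm_le_const fun t ht => ?_
      replace ht := Set.uIoc_subset_uIcc ht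
      have htz : 0 < ‖(t : ℂ) - z‖ := norm_pos_iff.mpr fun h0 => by
        have := congrArg im h0
        simp at this
        linarith
      rw [norm_div, norm_mul, div_le_iff₀ htz]
      have hb : ‖1 - (t : ℂ) ^ 2‖ ≤ 4 * ‖(t : ℂ) - z‖ := by
        rw [Set.uIcc_of_le (by norm_num)] at ht
        have e : ‖1 - (t : ℂ) ^ 2‖ = |1 - t ^ 2| := by
          rw [← ofReal_one, ← ofReal_pow, ← ofReal_sub, norm_real, Real.norm_eq_abs]
        have a1 := abs_re_le_norm ((t : ℂ) - z)
        have a2 := abs_im_le_norm ((t : ℂ) - z)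
        simp only [sub_re, ofReal_re, sub_im, ofReal_im, zero_sub, abs_neg] at a1 a2
        have a3 := abs_sub_abs_le_abs_sub z.re t
        rw [abs_sub_comm] at a3
        have a4 := le_abs_self z.im
        have ht1 : |t| ≤ 1 := abs_le.mpr ht
        have e2 : 1 - t ^ 2 = (1 - |t|) * (1 + |t|) := by rw [← sq_abs]; ring
        rw [e, e2, abs_of_nonneg (mul_nonneg (by linarith) (by positivity))]
        nlinarith [abs_nonneg t]
      have := hM t (ofReal_mem_baseSquare ht)
      calc _ ≤ (4 * ‖(t : ℂ) - z‖) * M := by gcongr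
        _ = _ := by ring
    norm_num at hI
    rw [squareLocalize, norm_mul]
    calc _ ≤ 1 * (4 * M * 2 + 36 * M) := by
          gcongr
          exact (norm_sub_le _ _).trans (add_le_add hI hN)
      _ ≤ 100 * M := by linarith
  · have hx := abs_lt.mp (show |z.re| < 1 by linarith)
    have hy : z.im < 1 := by linarith [abs_nonneg z.re]
    rw [squareLocalize_eq hp hx.1 hx.2 hz (by linarith)]
    have hzS : z ∈ baseSquare := ⟨⟨hx.1.le, hx.2.le⟩, ⟨hz.le, by linarith⟩⟩
    have hI : ‖upperSidesIntegral fun ζ => (1 - ζ ^ 2) * p ζ / (ζ - z)‖ ≤ 6 * (8 * M) := by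
      refine norm_upperSidesIntegral_le fun ζ hζ => ?_
      have hζS := upperSides_subset_baseSquare hζ
      have hb : ‖1 - ζ ^ 2‖ ≤ 8 * ‖ζ - z‖ ∧ 0 < ‖ζ - z‖ := by
        obtain ⟨⟨⟨b1, b2⟩, ⟨b3, b4⟩⟩, hs⟩ := hζ
        have a1 := abs_re_le_norm (ζ - z)
        have a2 := abs_im_le_norm (ζ - z)
        rw [sub_re] at a1
        rw [sub_im] at a2
        have e : ‖1 - ζ ^ 2‖ = ‖1 - ζ‖ * ‖1 + ζ‖ := by rw [← norm_mul]; congr 1; ring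
        have c1 := norm_le_abs_re_add_abs_im (1 - ζ)
        have c2 := norm_le_abs_re_add_abs_im (1 + ζ)
        simp only [sub_re, sub_im, add_re, add_im, one_re, one_im, zero_sub, zero_add, abs_neg]
          at c1 c2
        rw [abs_of_nonneg b3] at c1 c2
        rcases hs with hs | hs | hs
        · have := le_abs_self (ζ.im - z.im)
          have := norm_one_sub_sq_le hζS
          exact ⟨by linarith, by linarith⟩
        · rw [hs] at a1 c1 c2
          norm_num at c1 c2
          have d1 := le_abs_self (1 - z.re)
          have d2 := le_abs_self (ζ.im - z.im)
          have d3 := le_abs_self z.re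
          refine ⟨?_, by linarith⟩
          rw [e]
          nlinarith [norm_nonneg (1 - ζ), norm_nonneg (1 + ζ)]
        · rw [hs] at a1 c1 c2
          norm_num at c1 c2
          have d1 := neg_le_abs (-1 - z.re)
          have d2 := le_abs_self (ζ.im - z.im)
          have d3 := neg_le_abs z.re
          refine ⟨?_, by linarith⟩
          rw [e]
          nlinarith [norm_nonneg (1 - ζ), norm_nonneg (1 + ζ)]
      rw [norm_div, norm_mul, div_le_iff₀ hb.2]
      have := hM ζ hζS
      calc _ ≤ (8 * ‖ζ - z‖) * M := by gcongr; exact hb.1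
        _ = _ := by ring
    have hz2 := norm_one_sub_sq_le hzS
    have hpz := hM z hzS
    calc _ ≤ 6 * M + 1 * (6 * (8 * M) + 36 * M) := by
          refine (norm_add_le _ _).trans ?_
          rw [norm_mul, norm_mul]
          gcongr
          exact (norm_sub_le _ _).trans (add_le_add hI hN)
      _ ≤ 100 * M := by linarith

theorem norm_squareLocalize_sub_le {p : ℂ → ℂ} {M : ℝ} {z : ℂ}
    (hp : DifferentiableOn ℂ p baseSquare) (hM : ∀ ζ ∈ baseSquare, ‖p ζ‖ ≤ M)
    (hz : 0 < z.im) (hz' : ‖z‖ ≤ 1 / 2) :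
    ‖squareLocalize p z - p z‖ ≤ 100 * M * ‖z‖ := by
  have hx := abs_le.mp ((abs_re_le_norm z).trans hz')
  have hy := abs_le.mp ((abs_im_le_norm z).trans hz')
  have hzS : z ∈ baseSquare := ⟨⟨by linarith, by linarith⟩, ⟨hz.le, by linarith⟩⟩
  have hpz := hM z hzS
  have hM0 : 0 ≤ M := (norm_nonneg _).trans hpz
  have hsz : ∀ ζ ∈ upperSides, 1 / 2 ≤ ‖ζ - z‖ := fun ζ hζ => by
    linarith [one_le_norm_of_mem_upperSides hζ, norm_sub_norm_le ζ z]
  have hne : ∀ ζ ∈ upperSides, ζ - z ≠ 0 := fun ζ hζ =>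
    norm_pos_iff.mp (by linarith [hsz ζ hζ])
  have hne0 : ∀ ζ ∈ upperSides, ζ ≠ 0 := fun ζ hζ =>
    norm_pos_iff.mp (by linarith [one_le_norm_of_mem_upperSides hζ])
  have hpc := hp.continuousOn.mono upperSides_subset_baseSquare
  rw [squareLocalize_eq hp (by linarith) (by linarith) hz (by linarith),
    ← upperSidesIntegral_sub (f := fun ζ => (1 - ζ ^ 2) * p ζ / (ζ - z))
      (g := fun ζ => (1 - ζ ^ 2) * p ζ / ζ) (ContinuousOn.div (by fun_prop) (by fun_prop) hne)
      (ContinuousOn.div (by fun_prop) (by fun_prop) hne0)]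
  have hI : ‖upperSidesIntegral fun ζ => (1 - ζ ^ 2) * p ζ / (ζ - z) - (1 - ζ ^ 2) * p ζ / ζ‖ ≤
      6 * (12 * M * ‖z‖) := by
    refine norm_upperSidesIntegral_le fun ζ hζ => ?_
    have hζS := upperSides_subset_baseSquare hζ
    -- The difference of the kernels at `z` and `0` supplies the factor `z`.
    have e : (1 - ζ ^ 2) * p ζ / (ζ - z) - (1 - ζ ^ 2) * p ζ / ζ =
        (1 - ζ ^ 2) * p ζ * z / ((ζ - z) * ζ) := by
      have := hne ζ hζ
      have := hne0 ζ hζ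
      field_simp
      ring
    have h1 := hsz ζ hζ
    have h2 := one_le_norm_of_mem_upperSides hζ
    rw [e, norm_div, norm_mul, norm_mul, norm_mul, div_le_iff₀ (by positivity)]
    calc _ ≤ 6 * M * ‖z‖ := by gcongr; exacts [norm_one_sub_sq_le hζS, hM ζ hζS]
      _ = 12 * M * ‖z‖ * (1 / 2 * 1) := by ring
      _ ≤ _ := by gcongr
  have hpi := norm_two_pi_I_inv_le
  calc _ = ‖-(z * (z * p z)) + (2 * Real.pi * I)⁻¹ * upperSidesIntegral fun ζ =>
        (1 - ζ ^ 2) * p ζ / (ζ - z) - (1 - ζ ^ 2) * p ζ / ζ‖ := by congr 1; ring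
    _ ≤ ‖z‖ * (1 / 2 * M) + 1 * (6 * (12 * M * ‖z‖)) := by
      refine (norm_add_le _ _).trans ?_
      rw [norm_neg, norm_mul, norm_mul, norm_mul]
      gcongr
    _ ≤ _ := by nlinarith [mul_nonneg hM0 (norm_nonneg z)]

end SquareLocalization

/-! ### Cayley transforms between the disc and the upper half plane. -/

section Cayley

open Complex

/-- The Cayley transform from the upper half plane to the unit disc that sends `0` to `w`. -/
noncomputable def cayley (w s : ℂ) : ℂ := w * ((I - s) / (I + s))

/-- The inverse of the Cayley transform. -/
noncomputable def cayleyInv (w z : ℂ) : ℂ := I * (w - z) / (w + z)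

theorem I_add_ne_zero {s : ℂ} (hs : 0 ≤ s.im) : I + s ≠ 0 := fun h => by
  have := congrArg im h
  simp at this
  linarith

theorem one_le_norm_I_add {s : ℂ} (hs : 0 ≤ s.im) : 1 ≤ ‖I + s‖ := by
  refine le_trans ?_ (abs_im_le_norm _)
  rw [add_im, I_im, abs_of_nonneg (by linarith)]
  linarith

theorem norm_cayley_lt_one {w s : ℂ} (hw : ‖w‖ = 1) (hs : 0 < s.im) : ‖cayley w s‖ < 1 := by
  rw [cayley, norm_mul, hw, one_mul, norm_div,
    div_lt_one (by linarith [one_le_norm_I_add hs.le])]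
  refine lt_of_pow_lt_pow_left₀ 2 (norm_nonneg _) ?_
  rw [Complex.sq_norm, Complex.sq_norm, normSq_apply, normSq_apply]
  simp
  nlinarith

theorem norm_cayley_sub_le {w s : ℂ} (hw : ‖w‖ = 1) (hs : 0 ≤ s.im) :
    ‖cayley w s - w‖ ≤ 2 * ‖s‖ := by
  have h1 := one_le_norm_I_add hs
  have e : cayley w s - w = w * (-2 * s / (I + s)) := by
    have := I_add_ne_zero hs
    rw [cayley]; field_simp; ring
  rw [e, norm_mul, hw, one_mul, norm_div, div_le_iff₀ (by linarith), norm_mul]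
  norm_num
  nlinarith [norm_nonneg s]

theorem differentiableAt_cayley {w s : ℂ} (hs : 0 ≤ s.im) : DifferentiableAt ℂ (cayley w) s := by
  have := I_add_ne_zero hs
  unfold cayley
  fun_prop (disch := assumption)

theorem add_ne_zero_of_norm_lt {w z : ℂ} (h : ‖z‖ < ‖w‖) : w + z ≠ 0 := fun h0 => by
  rw [eq_neg_of_add_eq_zero_left h0, norm_neg] at h
  exact lt_irrefl _ h

theorem cayleyInv_im_pos {w z : ℂ} (hw : ‖w‖ = 1) (hz : ‖z‖ < 1) : 0 < (cayleyInv w z).im := by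
  have hne := add_ne_zero_of_norm_lt (w := w) (z := z) (by rwa [hw])
  have h0 : 0 < normSq (w + z) := normSq_pos.mpr hne
  have e1 : normSq w = 1 := by rw [normSq_eq_norm_sq, hw]; norm_num
  have e2 : normSq z < 1 := by rw [normSq_eq_norm_sq]; nlinarith [norm_nonneg z]
  have e : (cayleyInv w z).im = (normSq w - normSq z) / normSq (w + z) := by
    rw [cayleyInv, div_im]
    simp only [normSq_apply w, normSq_apply z]
    simp
    field_simp
    ring
  rw [e, e1]
  exact div_pos (by linarith) h0

theorem cayley_cayleyInv {w z : ℂ} (hw : ‖w‖ = 1) (hz : ‖z‖ < 1) :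
    cayley w (cayleyInv w z) = z := by
  have hne := add_ne_zero_of_norm_lt (w := w) (z := z) (by rwa [hw])
  have hw0 : w ≠ 0 := norm_pos_iff.mp (by rw [hw]; norm_num)
  have h1 : I - cayleyInv w z = 2 * I * z / (w + z) := by rw [cayleyInv]; field_simp; ring
  have h2 : I + cayleyInv w z = 2 * I * w / (w + z) := by rw [cayleyInv]; field_simp; ring
  rw [cayley, h1, h2]
  field_simp

theorem norm_cayleyInv_le {w z : ℂ} (hw : ‖w‖ = 1) (hz : ‖z - w‖ ≤ 1) :
    ‖cayleyInv w z‖ ≤ ‖z - w‖ := by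
  have h1 : 1 ≤ ‖w + z‖ := by
    have h2 : ‖(2 : ℂ) * w‖ = 2 := by rw [norm_mul, hw]; norm_num
    have := norm_sub_le (w + z) (z - w)
    rw [show w + z - (z - w) = 2 * w by ring, h2] at this
    linarith
  rw [cayleyInv, norm_div, norm_mul, norm_I, one_mul, norm_sub_rev]
  exact div_le_self (norm_nonneg _) h1

theorem differentiableAt_cayleyInv {w z : ℂ} (hw : ‖w‖ = 1) (hz : ‖z‖ < 1) :
    DifferentiableAt ℂ (cayleyInv w) z := by
  have := add_ne_zero_of_norm_lt (w := w) (z := z) (by rwa [hw])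
  unfold cayleyInv
  fun_prop (disch := assumption)

end Cayley

/-! ### Holomorphic dependence of the localization on a parameter. -/

section Localization

open Complex

variable {X : Type*} [NormedAddCommGroup X] [NormedSpace ℂ X]

theorem differentiableOn_upperSidesIntegral {V : Set X} (hV : IsOpen V) {F : ℂ → X → ℂ} {M : ℝ}
    (hF : ∀ ζ ∈ upperSides, DifferentiableOn ℂ (F ζ) V)
    (hb : ∀ ζ ∈ upperSides, ∀ x ∈ V, ‖F ζ x‖ ≤ M)
    (hc : ∀ x ∈ V, ContinuousOn (fun ζ => F ζ x) upperSides) :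
    DifferentiableOn ℂ (fun x => upperSidesIntegral fun ζ => F ζ x) V := by
  have key : ∀ (γ : ℝ → ℂ) (a b : ℝ), Continuous γ → (∀ t ∈ Set.uIcc a b, γ t ∈ upperSides) →
      DifferentiableOn ℂ (fun x => ∫ t in a..b, F (γ t) x) V := fun γ a b hγ hm => by
    refine differentiableOn_intervalIntegral (F := fun t => F (γ t)) hV (fun t ht => hF _ (hm t ht))
      (fun x hx => ?_) fun x hx => (hc x hx).comp hγ.continuousOn hm
    obtain ⟨r, hr, hrV⟩ := Metric.isOpen_iff.mp hV x hx
    exact ⟨r, hr, M, fun t ht y hy => hb _ (hm t ht) y (hrV hy)⟩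
  have h1 := key (fun t => t + 2 * I) (-1) 1 (by fun_prop) fun t ht => top_mem_upperSides ht
  have h2 := key (fun y => 1 + y * I) 0 2 (by fun_prop) fun t ht => right_mem_upperSides ht
  have h3 := key (fun y => -1 + y * I) 0 2 (by fun_prop) fun t ht => left_mem_upperSides ht
  exact (h1.sub (h2.const_mul I)).add (h3.const_mul I)

theorem differentiableOn_squareLocalize {V : Set X} (hV : IsOpen V) {p : ℂ → X → ℂ} {M : ℝ}
    {k : X → ℂ} (hp : ∀ ζ ∈ baseSquare, DifferentiableOn ℂ (p ζ) V)
    (hb : ∀ ζ ∈ baseSquare, ∀ x ∈ V, ‖p ζ x‖ ≤ M)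
    (hc : ∀ x ∈ V, ContinuousOn (fun ζ => p ζ x) baseSquare)
    (hk : DifferentiableOn ℂ k V) (hk0 : ∀ x ∈ V, 0 < (k x).im) :
    DifferentiableOn ℂ (fun x => squareLocalize (fun ζ => p ζ x) (k x)) V := by
  have hne : ∀ t : ℝ, ∀ x ∈ V, (t : ℂ) - k x ≠ 0 := fun t x hx h0 => by
    have h1 := congrArg im h0
    have h2 := hk0 x hx
    simp at h1
    linarith
  refine DifferentiableOn.const_mul (DifferentiableOn.sub ?_ ?_) _
  · refine differentiableOn_intervalIntegral
      (F := fun t x => (1 - (t : ℂ) ^ 2) * p t x / (t - k x)) hV (fun t ht => ?_) (fun x hx => ?_)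
      (fun x hx => ?_)
    · simp only [div_eq_mul_inv]
      exact ((hp t (ofReal_mem_baseSquare ht)).const_mul _).fun_mul
        ((hk.const_sub _).fun_inv fun x hx => hne t x hx)
    -- The Cauchy kernel is bounded only locally in `x`, by the distance of `k x` from the real
    -- axis.
    · have hev : ∀ᶠ y in 𝓝 x, (k x).im / 2 < (k y).im :=
        (continuous_im.continuousAt.comp (hk.differentiableAt (hV.mem_nhds hx)).continuousAt)
          |>.eventually_const_lt (half_lt_self (hk0 x hx))
      obtain ⟨r, hr, hrV⟩ := Metric.mem_nhds_iff.mp (hev.and (hV.mem_nhds hx))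
      refine ⟨r, hr, 6 * M / ((k x).im / 2), fun t ht y hy => ?_⟩
      obtain ⟨hy1, hy2⟩ := hrV hy
      have h0 := hk0 x hx
      have h1 := abs_im_le_norm ((t : ℂ) - k y)
      have h2 := le_abs_self (k y).im
      simp only [sub_im, ofReal_im, zero_sub, abs_neg] at h1
      have hS := ofReal_mem_baseSquare ht
      have hpM := hb t hS y hy2
      rw [norm_div, norm_mul]
      gcongr
      · exact mul_nonneg (by norm_num) ((norm_nonneg _).trans hpM)
      · exact norm_one_sub_sq_le hS
      · linarith
    · refine ContinuousOn.div (ContinuousOn.mul (by fun_prop) ?_) (by fun_prop)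
        fun t _ => hne t x hx
      exact (hc x hx).comp (by fun_prop) fun t ht => ofReal_mem_baseSquare ht
  · refine differentiableOn_upperSidesIntegral (F := fun ζ x => (1 - ζ ^ 2) * p ζ x / ζ)
      (M := 6 * M) hV (fun ζ hζ => ?_) (fun ζ hζ x hx => ?_) (fun x hx => ?_)
    · simp only [div_eq_mul_inv]
      exact ((hp ζ (upperSides_subset_baseSquare hζ)).const_mul _).mul_const _
    · have hS := upperSides_subset_baseSquare hζ
      have hpM := hb ζ hS x hx
      have hM0 := (norm_nonneg _).trans hpM
      rw [norm_div, norm_mul]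
      refine (div_le_self (by positivity) (one_le_norm_of_mem_upperSides hζ)).trans ?_
      gcongr
      exact norm_one_sub_sq_le hS
    · refine ContinuousOn.div (ContinuousOn.mul (by fun_prop) ?_) (by fun_prop) fun ζ hζ =>
        norm_pos_iff.mp (by linarith [one_le_norm_of_mem_upperSides hζ])
      exact (hc x hx).mono upperSides_subset_baseSquare

end Localization

/-! ### Localization near a point of the closed disc. -/

section LocalizationTheorem

variable {X : Type*} [NormedAddCommGroup X] [NormedSpace ℂ X]

open Complex in
-- `squareLocalize` is applied in the half plane, with `w` moved to `0`. The constant depends only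
-- on `w` and `ε`; this uniformity later allows limits over shrinking bumps.
theorem exists_localization_of_norm_eq_one {w : ℂ} (hw : ‖w‖ = 1) {ε : ℝ} (hε : 0 < ε) :
    ∃ C : ℝ, 0 ≤ C ∧ ∀ (V : Set X) (ℓ : X → ℂ) (g : ℂ → X → ℂ) (M : ℝ), IsOpen V → 0 ≤ M →
      DifferentiableOn ℂ ℓ V → (∀ x ∈ V, ‖ℓ x‖ < 1) →
      DifferentiableOn ℂ (fun q : ℂ × X => g q.1 q.2)
        ((Metric.ball 0 1 ∩ Metric.ball w ε) ×ˢ V) →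
      (∀ ζ ∈ Metric.ball 0 1 ∩ Metric.ball w ε, ∀ x ∈ V, ‖g ζ x‖ ≤ M) →
      ∃ P : X → ℂ, DifferentiableOn ℂ P V ∧ (∀ x ∈ V, ‖P x‖ ≤ C * M) ∧
        ∀ x ∈ V, ‖ℓ x - w‖ < ε → ‖P x - g (ℓ x) x‖ ≤ C * M * ‖ℓ x - w‖ := by
  -- Points of the scaled and shifted square have norm below `4 * ρ`, so their Cayley images stay
  -- within `8 * ρ < ε` of `w`.
  obtain ⟨ρ, hρ, hρε⟩ : ∃ ρ > 0, 16 * ρ = ε := ⟨ε / 16, by positivity, by ring⟩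
  obtain ⟨r, hr, hrρ, hr1⟩ : ∃ r > 0, r ≤ ρ / 2 ∧ r ≤ 1 :=
    ⟨min (ρ / 2) 1, by positivity, min_le_left _ _, min_le_right _ _⟩
  refine ⟨100 + 100 / ρ + 101 / r, by positivity, fun V ℓ g M hV hM hℓ hℓ1 hg hgM => ?_⟩
  have hΔ : ∀ σ ∈ Set.Ioo 0 ρ, ∀ s ∈ baseSquare,
      0 < (ρ * s + σ * I : ℂ).im ∧
        cayley w (ρ * s + σ * I) ∈ Metric.ball 0 1 ∩ Metric.ball w ε := by
    rintro σ ⟨hσ, hσρ⟩ s ⟨⟨h1, h2⟩, ⟨h3, h4⟩⟩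
    have him : 0 < (ρ * s + σ * I : ℂ).im := by
      have : 0 ≤ ρ * s.im := mul_nonneg hρ.le h3
      simp
      linarith
    refine ⟨him, by simpa using norm_cayley_lt_one hw him, mem_ball_iff_norm.mpr ?_⟩
    have hs : ‖s‖ ≤ 3 := by
      have := norm_le_abs_re_add_abs_im s
      have := abs_le.mpr ⟨h1, h2⟩
      rw [abs_of_nonneg h3] at *
      linarith
    have hn : ‖(ρ * s + σ * I : ℂ)‖ ≤ ρ * 3 + σ := by
      refine (norm_add_le _ _).trans ?_
      simp only [norm_mul, norm_real, norm_I, mul_one, Real.norm_eq_abs, abs_of_pos hρ,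
        abs_of_pos hσ]
      gcongr
    have := norm_cayley_sub_le hw him.le
    linarith
  -- `g` need not extend to the unit circle, so the square is lifted by `σ` into the open half
  -- plane, and `σ` tends to `0` afterwards.
  let p : ℝ → ℂ → X → ℂ := fun σ s x => g (cayley w (ρ * s + σ * I)) x
  have hpd : ∀ σ ∈ Set.Ioo 0 ρ, ∀ x ∈ V, DifferentiableOn ℂ (fun s => p σ s x) baseSquare := by
    intro σ hσ x hx
    refine hg.comp (f := fun s => (cayley w (ρ * s + σ * I), x)) ?_
      fun s hs => ⟨(hΔ σ hσ s hs).2, hx⟩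
    refine DifferentiableOn.prodMk (fun s hs => ?_) (differentiableOn_const x)
    have := differentiableAt_cayley (w := w) (hΔ σ hσ s hs).1.le
    exact (DifferentiableAt.fun_comp' s this (by fun_prop)).differentiableWithinAt
  have hpx : ∀ σ ∈ Set.Ioo 0 ρ, ∀ s ∈ baseSquare, DifferentiableOn ℂ (p σ s) V := by
    intro σ hσ s hs
    exact hg.comp (f := fun x => (cayley w (ρ * s + σ * I), x)) (by fun_prop)
      fun x hx => ⟨(hΔ σ hσ s hs).2, hx⟩
  have hpM : ∀ σ ∈ Set.Ioo 0 ρ, ∀ s ∈ baseSquare, ∀ x ∈ V, ‖p σ s x‖ ≤ M :=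
    fun σ hσ s hs x hx => hgM _ (hΔ σ hσ s hs).2 x hx
  let k : X → ℂ := fun x => (ρ : ℂ)⁻¹ * cayleyInv w (ℓ x)
  have hkd : DifferentiableOn ℂ k V := fun x hx =>
    ((DifferentiableAt.fun_comp' x (differentiableAt_cayleyInv hw (hℓ1 x hx))
      (hℓ.differentiableAt (hV.mem_nhds hx))).const_mul _).differentiableWithinAt
  have hk0 : ∀ x ∈ V, 0 < (k x).im := fun x hx => by
    simp only [k, ← ofReal_inv, im_ofReal_mul]
    exact mul_pos (inv_pos.mpr hρ) (cayleyInv_im_pos hw (hℓ1 x hx))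
  have hIoo : Set.Ioo 0 ρ ∈ 𝓝[>] (0 : ℝ) := Ioo_mem_nhdsGT hρ
  obtain ⟨𝒰, P, h𝒰, hPd, hPM, hPlim⟩ := exists_ultrafilter_tendsto_differentiableOn (𝓝[>] (0 : ℝ))
    hV (F := fun σ x => squareLocalize (fun s => p σ s x) (k x)) (M := 100 * M) (by
      filter_upwards [hIoo] with σ hσ
      exact ⟨differentiableOn_squareLocalize hV (hpx σ hσ) (hpM σ hσ)
        (fun x hx => (hpd σ hσ x hx).continuousOn) hkd hk0, fun x hx =>
        norm_squareLocalize_le (hpd σ hσ x hx) (fun s hs => hpM σ hσ s hs x hx) (hk0 x hx)⟩)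
  have hC1 : 0 ≤ 100 / ρ := by positivity
  have hC2 : 0 ≤ 101 / r := by positivity
  refine ⟨P, hPd, fun x hx => (hPM x hx).trans (by nlinarith), fun x hx hxw => ?_⟩
  have hxΔ : ℓ x ∈ Metric.ball (0 : ℂ) 1 ∩ Metric.ball w ε :=
    ⟨by simpa using hℓ1 x hx, mem_ball_iff_norm.mpr hxw⟩
  rcases lt_or_ge ‖ℓ x - w‖ r with hlt | hge
  · have hkn : ‖k x‖ ≤ ρ⁻¹ * ‖ℓ x - w‖ := by
      simp only [k, norm_mul, norm_inv, norm_real, Real.norm_eq_abs, abs_of_pos hρ]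
      gcongr
      exact norm_cayleyInv_le hw (by linarith)
    have hk2 : ‖k x‖ ≤ 1 / 2 := by
      refine hkn.trans ?_
      rw [inv_mul_le_iff₀ hρ]
      linarith
    have hglim : Tendsto (fun σ : ℝ => p σ (k x) x) 𝒰 (𝓝 (g (ℓ x) x)) := by
      have hk : ∀ σ : ℝ, (ρ : ℂ) * k x + σ * I = cayleyInv w (ℓ x) + σ * I := fun σ => by
        have : (ρ : ℂ) ≠ 0 := ofReal_ne_zero.mpr hρ.ne'
        simp only [k]; field_simp
      have hlim : Tendsto (fun σ : ℝ => cayley w (ρ * k x + σ * I)) (𝓝 0) (𝓝 (ℓ x)) := by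
        simp only [hk]
        have h1 : Tendsto (fun σ : ℝ => cayleyInv w (ℓ x) + σ * I) (𝓝 0)
            (𝓝 (cayleyInv w (ℓ x))) := by
          have : Continuous fun σ : ℝ => cayleyInv w (ℓ x) + σ * I := by fun_prop
          simpa using this.tendsto 0
        have h2 := (differentiableAt_cayley (w := w)
          (cayleyInv_im_pos hw (hℓ1 x hx)).le).continuousAt.tendsto.comp h1
        rwa [cayley_cayleyInv hw (hℓ1 x hx)] at h2
      have hgc : ContinuousAt (fun q : ℂ × X => g q.1 q.2) (ℓ x, x) :=
        hg.continuousOn.continuousAt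
          (((Metric.isOpen_ball.inter Metric.isOpen_ball).prod hV).mem_nhds ⟨hxΔ, hx⟩)
      exact (hgc.tendsto.comp (hlim.prodMk_nhds tendsto_const_nhds)).mono_left
        (h𝒰.trans nhdsWithin_le_nhds)
    have : ‖P x - g (ℓ x) x‖ ≤ 100 * M * ‖k x‖ := by
      refine le_of_tendsto ((hPlim x hx).sub hglim).norm ?_
      filter_upwards [h𝒰 hIoo] with σ hσ
      exact norm_squareLocalize_sub_le (hpd σ hσ x hx) (fun s hs => hpM σ hσ s hs x hx) (hk0 x hx)
        hk2
    calc _ ≤ 100 * M * ‖k x‖ := this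
      _ ≤ 100 * M * (ρ⁻¹ * ‖ℓ x - w‖) := by gcongr
      _ = 100 / ρ * M * ‖ℓ x - w‖ := by ring
      _ ≤ _ := by gcongr; linarith
  -- Away from `w` the factor `‖ℓ x - w‖ ≥ r` makes the crude bound `101 * M` sufficient.
  · calc _ ≤ 100 * M + M := (norm_sub_le _ _).trans (add_le_add (hPM x hx) (hgM _ hxΔ x hx))
      _ = 101 / r * M * r := by field_simp; ring
      _ ≤ _ := by gcongr; linarith

/-- At an interior point, freezing `ζ = w` is enough: the error is controlled by the Schwarz lemma
on a small disc around `w`. -/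
theorem exists_localization_of_norm_lt_one {w : ℂ} (hw : ‖w‖ < 1) {ε : ℝ} (hε : 0 < ε) :
    ∃ C : ℝ, 0 ≤ C ∧ ∀ (V : Set X) (ℓ : X → ℂ) (g : ℂ → X → ℂ) (M : ℝ), 0 ≤ M →
      (∀ x ∈ V, ‖ℓ x‖ < 1) →
      DifferentiableOn ℂ (fun q : ℂ × X => g q.1 q.2)
        ((Metric.ball 0 1 ∩ Metric.ball w ε) ×ˢ V) →
      (∀ ζ ∈ Metric.ball 0 1 ∩ Metric.ball w ε, ∀ x ∈ V, ‖g ζ x‖ ≤ M) →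
      ∃ P : X → ℂ, DifferentiableOn ℂ P V ∧ (∀ x ∈ V, ‖P x‖ ≤ C * M) ∧
        ∀ x ∈ V, ‖ℓ x - w‖ < ε → ‖P x - g (ℓ x) x‖ ≤ C * M * ‖ℓ x - w‖ := by
  obtain ⟨r, hr, hrε, hr1⟩ : ∃ r > 0, r ≤ ε ∧ r ≤ 1 - ‖w‖ :=
    ⟨min ε (1 - ‖w‖), lt_min hε (by linarith), min_le_left _ _, min_le_right _ _⟩
  have hsub : Metric.ball w r ⊆ Metric.ball 0 1 ∩ Metric.ball w ε := fun ζ hζ => by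
    refine ⟨?_, Metric.ball_subset_ball hrε hζ⟩
    rw [mem_ball_iff_norm] at hζ
    rw [mem_ball_zero_iff]
    linarith [norm_le_norm_add_norm_sub w ζ, norm_sub_rev w ζ]
  have hwΔ := hsub (Metric.mem_ball_self hr)
  refine ⟨1 + 2 / r, by positivity, fun V ℓ g M hM hℓ1 hg hgM => ⟨g w, ?_, fun x hx => ?_,
    fun x hx hxw => ?_⟩⟩
  · exact hg.comp (f := fun x => (w, x)) (by fun_prop) fun x hx => ⟨hwΔ, hx⟩
  · refine (hgM w hwΔ x hx).trans ?_
    have : 0 ≤ 2 / r := by positivity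
    nlinarith
  · have hx2 : ∀ ζ ∈ Metric.ball 0 1 ∩ Metric.ball w ε, ‖g ζ x - g w x‖ ≤ 2 * M := fun ζ hζ => by
      linarith [norm_sub_le (g ζ x) (g w x), hgM ζ hζ x hx, hgM w hwΔ x hx]
    rw [norm_sub_rev]
    suffices ‖g (ℓ x) x - g w x‖ ≤ 2 * M / r * ‖ℓ x - w‖ by
      refine this.trans ?_
      gcongr
      rw [add_mul, one_mul, div_mul_eq_mul_div]
      linarith
    rcases lt_or_ge ‖ℓ x - w‖ r with hlt | hge
    · have hd : DifferentiableOn ℂ (fun ζ => g ζ x) (Metric.ball w r) :=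
        hg.comp (f := fun ζ => (ζ, x)) (by fun_prop) fun ζ hζ => ⟨hsub hζ, hx⟩
      simpa [dist_eq_norm] using Complex.dist_le_div_mul_dist_of_mapsTo_ball hd
        (fun ζ hζ => mem_closedBall_iff_norm.mpr (hx2 ζ (hsub hζ))) (mem_ball_iff_norm.mpr hlt)
    · calc _ ≤ 2 * M := hx2 _ ⟨by simpa using hℓ1 x hx, mem_ball_iff_norm.mpr hxw⟩
        _ = 2 * M / r * r := by field_simp
        _ ≤ _ := by gcongr

/-- Localization: a bounded holomorphic function of `(ζ, x)`, defined for `ζ` in the unit disc close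
to a point `w` of the closed disc, agrees on the graph of `ℓ` with a bounded holomorphic
function of `x`, up to an error dominated by `ℓ - w`. -/
theorem exists_localization {w : ℂ} (hw : ‖w‖ ≤ 1) {ε : ℝ} (hε : 0 < ε) :
    ∃ C : ℝ, 0 ≤ C ∧ ∀ (V : Set X) (ℓ : X → ℂ) (g : ℂ → X → ℂ) (M : ℝ), IsOpen V → 0 ≤ M →
      DifferentiableOn ℂ ℓ V → (∀ x ∈ V, ‖ℓ x‖ < 1) →
      DifferentiableOn ℂ (fun q : ℂ × X => g q.1 q.2)
        ((Metric.ball 0 1 ∩ Metric.ball w ε) ×ˢ V) →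
      (∀ ζ ∈ Metric.ball 0 1 ∩ Metric.ball w ε, ∀ x ∈ V, ‖g ζ x‖ ≤ M) →
      ∃ P : X → ℂ, DifferentiableOn ℂ P V ∧ (∀ x ∈ V, ‖P x‖ ≤ C * M) ∧
        ∀ x ∈ V, ‖ℓ x - w‖ < ε → ‖P x - g (ℓ x) x‖ ≤ C * M * ‖ℓ x - w‖ := by
  rcases hw.lt_or_eq with hw | hw
  · obtain ⟨C, hC, h⟩ := exists_localization_of_norm_lt_one (X := X) hw hε
    exact ⟨C, hC, fun V ℓ g M _ hM _ => h V ℓ g M hM⟩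
  · exact exists_localization_of_norm_eq_one hw hε

end LocalizationTheorem

/-! ### The algebra of bounded holomorphic functions. -/

section BoundedHolomorphicOn

open Asymptotics

variable {X : Type*} [NormedAddCommGroup X] [NormedSpace ℂ X]

/-- `f` is bounded and holomorphic on `V`. -/
def BddHolOn (f : X → ℂ) (V : Set X) : Prop :=
  DifferentiableOn ℂ f V ∧ f =O[𝓟 V] fun _ => (1 : ℝ)

variable {f g : X → ℂ} {V : Set X}

theorem BddHolOn.const (c : ℂ) : BddHolOn (fun _ => c) V :=
  ⟨differentiableOn_const c, isBigO_const_const c one_ne_zero _⟩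

theorem BddHolOn.add (hf : BddHolOn f V) (hg : BddHolOn g V) : BddHolOn (fun x => f x + g x) V :=
  ⟨hf.1.add hg.1, hf.2.add hg.2⟩

theorem BddHolOn.sub (hf : BddHolOn f V) (hg : BddHolOn g V) : BddHolOn (fun x => f x - g x) V :=
  ⟨hf.1.sub hg.1, hf.2.sub hg.2⟩

theorem BddHolOn.mul (hf : BddHolOn f V) (hg : BddHolOn g V) : BddHolOn (fun x => f x * g x) V :=
  ⟨hf.1.mul hg.1, by simpa using hf.2.mul hg.2⟩

theorem BddHolOn.sum {ι : Type*} {T : Finset ι} {F : ι → X → ℂ} (h : ∀ i ∈ T, BddHolOn (F i) V) :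
    BddHolOn (fun x => ∑ i ∈ T, F i x) V :=
  ⟨DifferentiableOn.fun_sum fun i hi => (h i hi).1, IsBigO.fun_sum fun i hi => (h i hi).2⟩

theorem BddHolOn.mono {U : Set X} (hf : BddHolOn f V) (h : U ⊆ V) : BddHolOn f U :=
  ⟨hf.1.mono h, hf.2.mono (principal_mono.mpr h)⟩

theorem BddHolOn.exists_bound (hf : BddHolOn f V) : ∃ M, 0 ≤ M ∧ ∀ x ∈ V, ‖f x‖ ≤ M := by
  obtain ⟨c, hc⟩ := isBigO_principal.mp hf.2
  exact ⟨max c 0, le_max_right _ _, fun x hx => by simpa using Or.inl (by simpa using hc x hx)⟩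

end BoundedHolomorphicOn

/-! ### Bezout identities and removal of point constraints. -/

section PointNeighborhoods

open Asymptotics

variable {K : Type*} [TopologicalSpace K]

theorem differentiable_eval (t : K) : Differentiable ℂ fun x : C(K, ℂ) => x t :=
  (ContinuousMap.evalCLM ℂ t : C(K, ℂ) →L[ℂ] ℂ).differentiable

/-- The function `(1 - φ) x + φ ζ`. -/
noncomputable def blend (φ : C(K, ℝ)) (ζ : ℂ) (x : C(K, ℂ)) : C(K, ℂ) :=
  x + (⟨fun k => (φ k : ℂ), by fun_prop⟩ : C(K, ℂ)) * (ζ • 1 - x)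

theorem blend_apply (φ : C(K, ℝ)) (ζ : ℂ) (x : C(K, ℂ)) (k : K) :
    blend φ ζ x k = x k + φ k * (ζ - x k) := by
  simp [blend]

variable [CompactSpace K]

/-- The functions in the open unit ball of `C(K)` whose values at the points of `S` are `ε`-close
to prescribed values. -/
def pointNhd (w : K → ℂ) (ε : ℝ) (S : Finset K) : Set C(K, ℂ) :=
  {x | ‖x‖ < 1 ∧ ∀ s ∈ S, ‖x s - w s‖ < ε}

theorem isOpen_pointNhd (w : K → ℂ) (ε : ℝ) (S : Finset K) : IsOpen (pointNhd w ε S) := by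
  have : pointNhd w ε S = {x | ‖x‖ < 1} ∩ ⋂ s ∈ S, {x : C(K, ℂ) | ‖x s - w s‖ < ε} := by
    ext x; simp [pointNhd]
  rw [this]
  refine (isOpen_lt continuous_norm continuous_const).inter
    (isOpen_biInter_finset fun s _ => isOpen_lt ?_ continuous_const)
  fun_prop

theorem bddHolOn_eval_sub {V : Set C(K, ℂ)} (hV : ∀ x ∈ V, ‖x‖ < 1) (t : K) (c : ℂ) :
    BddHolOn (fun x : C(K, ℂ) => x t - c) V := by
  refine BddHolOn.sub ⟨(differentiable_eval t).differentiableOn, isBigO_principal.mpr ⟨1, ?_⟩⟩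
    (BddHolOn.const c)
  intro x hx
  simpa using (x.norm_coe_le_norm t).trans (hV x hx).le

theorem differentiable_blend (φ : C(K, ℝ)) :
    Differentiable ℂ fun q : ℂ × C(K, ℂ) => blend φ q.1 q.2 := by
  unfold blend
  fun_prop

theorem norm_blend_lt_one {φ : C(K, ℝ)} (hφ : ∀ k, φ k ∈ Set.Icc (0 : ℝ) 1) {ζ : ℂ} (hζ : ‖ζ‖ < 1)
    {x : C(K, ℂ)} (hx : ‖x‖ < 1) : ‖blend φ ζ x‖ < 1 := by
  rw [ContinuousMap.norm_lt_iff _ one_pos]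
  intro k
  obtain ⟨h0, h1⟩ := hφ k
  have hxk := (x.norm_coe_le_norm k).trans_lt hx
  have e : blend φ ζ x k = ((1 - φ k : ℝ) : ℂ) * x k + (φ k : ℂ) * ζ := by
    rw [blend_apply]; push_cast; ring
  rw [e]
  refine (norm_add_le _ _).trans_lt ?_
  rw [norm_mul, norm_mul, Complex.norm_real, Complex.norm_real, Real.norm_eq_abs, Real.norm_eq_abs,
    abs_of_nonneg h0, abs_of_nonneg (by linarith)]
  rcases h0.eq_or_lt with h | h
  · rw [← h]; simpa using hxk
  · nlinarith

theorem exists_bump [T2Space K] {t : K} {W : Set K} (hW : IsOpen W) (ht : t ∈ W) :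
    ∃ φ : C(K, ℝ), φ t = 1 ∧ (∀ k ∉ W, φ k = 0) ∧ ∀ k, φ k ∈ Set.Icc (0 : ℝ) 1 := by
  obtain ⟨φ, h0, h1, h⟩ := exists_continuous_zero_one_of_isClosed hW.isClosed_compl
    (isClosed_singleton (x := t)) (by simpa using ht)
  exact ⟨φ, h1 rfl, fun k hk => h0 hk, h⟩

/-- With a bump `φ` at `t` that vanishes on `S`, `blend φ ζ x` has value `ζ` at `t` and keeps the
values of `x` on `S`. So `G (blend φ ζ x)` is defined without any constraint on `x t`, and it can be
localized in `ζ` along `ζ = x t`. -/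
theorem exists_bddHolOn_approx_of_insert [T2Space K] [DecidableEq K] {w : K → ℂ} {ε : ℝ}
    (hε : 0 < ε) {S : Finset K} {t : K} (hwt : ‖w t‖ ≤ 1) (htS : t ∉ S) {G : C(K, ℂ) → ℂ}
    (hG : BddHolOn G (pointNhd w ε (insert t S))) :
    ∃ F, BddHolOn F (pointNhd w ε S) ∧
      (fun x => F x - G x) =O[𝓟 (pointNhd w ε (insert t S))] fun x => x t - w t := by
  obtain ⟨C, hC, hloc⟩ := exists_localization (X := C(K, ℂ)) hwt hε
  obtain ⟨M, hM0, hM⟩ := hG.exists_bound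
  have hbump : ∀ W : TopologicalSpace.OpenNhdsOf t, ∃ φ : C(K, ℝ), φ t = 1 ∧
      (∀ k ∉ (W : Set K) ∩ (S : Set K)ᶜ, φ k = 0) ∧ ∀ k, φ k ∈ Set.Icc (0 : ℝ) 1 := fun W =>
    exists_bump (W.isOpen.inter S.finite_toSet.isClosed.isOpen_compl) ⟨W.mem, by simpa using htS⟩
  choose φ hφt hφ0 hφ1 using hbump
  have hblend : ∀ W, ∀ ζ ∈ Metric.ball 0 1 ∩ Metric.ball (w t) ε, ∀ x ∈ pointNhd w ε S,
      blend (φ W) ζ x ∈ pointNhd w ε (insert t S) := by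
    rintro W ζ ⟨hζ1, hζw⟩ x ⟨hx1, hxS⟩
    refine ⟨norm_blend_lt_one (hφ1 W) (by simpa using hζ1) hx1, fun s hs => ?_⟩
    rw [blend_apply]
    rcases Finset.mem_insert.mp hs with rfl | hs
    · simpa [hφt, dist_eq_norm] using hζw
    · simpa [hφ0 W s (by simp [hs])] using hxS s hs
  have hP : ∀ W, ∃ P : C(K, ℂ) → ℂ, DifferentiableOn ℂ P (pointNhd w ε S) ∧
      (∀ x ∈ pointNhd w ε S, ‖P x‖ ≤ C * M) ∧ ∀ x ∈ pointNhd w ε S, ‖x t - w t‖ < ε →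
        ‖P x - G (blend (φ W) (x t) x)‖ ≤ C * M * ‖x t - w t‖ := fun W =>
    hloc (pointNhd w ε S) (fun x => x t) (fun ζ x => G (blend (φ W) ζ x)) M (isOpen_pointNhd _ _ _)
      hM0 (differentiable_eval t).differentiableOn
      (fun x hx => (x.norm_coe_le_norm t).trans_lt hx.1)
      (hG.1.comp (differentiable_blend (φ W)).differentiableOn fun q hq =>
        hblend W q.1 hq.1 q.2 hq.2)
      (fun ζ hζ x hx => hM _ (hblend W ζ hζ x hx))
  choose P hPd hPM hPG using hP
  obtain ⟨𝒰, F, h𝒰, hFd, hFM, hFlim⟩ := exists_ultrafilter_tendsto_differentiableOn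
    (atBot : Filter (TopologicalSpace.OpenNhdsOf t)) (isOpen_pointNhd w ε S) (F := P) (M := C * M)
    (Eventually.of_forall fun W => ⟨hPd W, hPM W⟩)
  refine ⟨F, ⟨hFd, isBigO_principal.mpr ⟨C * M, fun x hx => by simpa using hFM x hx⟩⟩,
    isBigO_principal.mpr ⟨C * M, fun x hx => ?_⟩⟩
  have hxS : x ∈ pointNhd w ε S := ⟨hx.1, fun s hs => hx.2 s (Finset.mem_insert_of_mem hs)⟩
  -- By continuity of `x` at `t`, writing the value `x t` near `t` changes `x` little in supremum
  -- norm once the bump is narrow.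
  have hb : Tendsto (fun W => blend (φ W) (x t) x) atBot (𝓝 x) := by
    rw [Metric.tendsto_nhds]
    intro η hη
    let W₀ : TopologicalSpace.OpenNhdsOf t :=
      ⟨⟨{k | ‖x t - x k‖ < η}, isOpen_lt (by fun_prop) continuous_const⟩, by simpa using hη⟩
    filter_upwards [eventually_le_atBot W₀] with W hW
    rw [dist_eq_norm, ContinuousMap.norm_lt_iff _ hη]
    intro k
    rw [ContinuousMap.sub_apply, blend_apply, add_sub_cancel_left, norm_mul, Complex.norm_real,
      Real.norm_eq_abs, abs_of_nonneg (hφ1 W k).1]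
    by_cases hk : k ∈ (W : Set K)
    · have : ‖x t - x k‖ < η := hW hk
      nlinarith [(hφ1 W k).1, (hφ1 W k).2, norm_nonneg (x t - x k)]
    · rw [hφ0 W k fun h => hk h.1, zero_mul]
      exact hη
  have hGc : ContinuousAt G x :=
    hG.1.continuousOn.continuousAt ((isOpen_pointNhd _ _ _).mem_nhds hx)
  refine le_of_tendsto ((hFlim x hxS).sub ((hGc.tendsto.comp hb).mono_left h𝒰)).norm
    (Eventually.of_forall fun W => hPG W x hxS (hx.2 t (Finset.mem_insert_self _ _)))

/-- `f` and the functions `x ↦ x s - w s`, `s ∈ T`, generate the unit ideal of the algebra of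
bounded holomorphic functions on `V`. -/
def HasBezoutOn (f : C(K, ℂ) → ℂ) (w : K → ℂ) (T : Finset K) (V : Set C(K, ℂ)) : Prop :=
  ∃ (g : C(K, ℂ) → ℂ) (h : K → C(K, ℂ) → ℂ), BddHolOn g V ∧ (∀ s ∈ T, BddHolOn (h s) V) ∧
    ∀ x ∈ V, f x * g x + ∑ s ∈ T, (x s - w s) * h s x = 1

/-- Extending every coefficient leaves a defect `e = O(x t - w t)`. Multiplying `1 - e` by `1 + e +
e ^ 2` turns it into `1 - e ^ 3`, and `e ^ 3` is divisible by `x t - w t`, so it can be added to the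
coefficient of index `t`. -/
theorem HasBezoutOn.of_insert [T2Space K] [DecidableEq K] {w : K → ℂ} {ε : ℝ}
    (hε : 0 < ε) {S T : Finset K} {t : K} (hwt : ‖w t‖ ≤ 1) (htS : t ∉ S) (htT : t ∈ T)
    {f : C(K, ℂ) → ℂ} (hf : BddHolOn f (pointNhd w ε S))
    (h : HasBezoutOn f w T (pointNhd w ε (insert t S))) :
    HasBezoutOn f w T (pointNhd w ε S) := by
  obtain ⟨g, h, hg, hh, heq⟩ := h
  have hsub : pointNhd w ε (insert t S) ⊆ pointNhd w ε S :=
    fun x hx => ⟨hx.1, fun s hs => hx.2 s (Finset.mem_insert_of_mem hs)⟩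
  obtain ⟨g₁, hg₁, hgg₁⟩ := exists_bddHolOn_approx_of_insert hε hwt htS hg
  have hh₁ : ∀ s, ∃ F, s ∈ T → BddHolOn F (pointNhd w ε S) ∧
      (fun x => F x - h s x) =O[𝓟 (pointNhd w ε (insert t S))] fun x => x t - w t := fun s => by
    by_cases hs : s ∈ T
    · obtain ⟨F, hF⟩ := exists_bddHolOn_approx_of_insert hε hwt htS (hh s hs)
      exact ⟨F, fun _ => hF⟩
    · exact ⟨0, fun h => absurd h hs⟩
  choose h₁ hh₁ using hh₁
  have hev : ∀ s, BddHolOn (fun x : C(K, ℂ) => x s - w s) (pointNhd w ε S) := fun s =>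
    bddHolOn_eval_sub (fun x hx => hx.1) s (w s)
  let e : C(K, ℂ) → ℂ := fun x => 1 - (f x * g₁ x + ∑ s ∈ T, (x s - w s) * h₁ s x)
  have he : BddHolOn e (pointNhd w ε S) := (BddHolOn.const 1).sub
    ((hf.mul hg₁).add (BddHolOn.sum fun s hs => (hev s).mul (hh₁ s hs).1))
  have he₁ : e =O[𝓟 (pointNhd w ε (insert t S))] fun x => x t - w t := by
    have h1 : (fun x => f x * (g₁ x - g x) + ∑ s ∈ T, (x s - w s) * (h₁ s x - h s x))
        =O[𝓟 (pointNhd w ε (insert t S))] fun x => x t - w t := by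
      refine IsBigO.add ?_ (IsBigO.fun_sum fun s hs => ?_)
      · simpa using (hf.mono hsub).2.norm_right.mul hgg₁.norm_right
      · simpa using ((hev s).mono hsub).2.norm_right.mul (hh₁ s hs).2.norm_right
    refine h1.neg_left.congr' ?_ EventuallyEq.rfl
    filter_upwards [mem_principal_self _] with x hx
    simp only [e, ← heq x hx, mul_sub, Finset.sum_sub_distrib]
    ring
  -- Where the constraint at `t` fails, `‖x t - w t‖ ≥ ε`, so boundedness of `e` suffices.
  have hea : e =O[𝓟 (pointNhd w ε S)] fun x => x t - w t := by
    have hle : 𝓟 (pointNhd w ε S) ≤ 𝓟 (pointNhd w ε (insert t S)) ⊔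
        𝓟 (pointNhd w ε S \ pointNhd w ε (insert t S)) := by
      rw [sup_principal, principal_mono]
      intro x hx
      by_cases h : x ∈ pointNhd w ε (insert t S)
      exacts [Or.inl h, Or.inr ⟨hx, h⟩]
    refine (IsBigO.sup he₁ ((he.mono Set.sdiff_subset).2.trans ?_)).mono hle
    refine isBigO_principal.mpr ⟨ε⁻¹, fun x hx => ?_⟩
    have : ε ≤ ‖x t - w t‖ := by
      by_contra hlt
      refine hx.2 ⟨hx.1.1, fun s hs => ?_⟩
      rcases Finset.mem_insert.mp hs with rfl | hs
      exacts [not_le.mp hlt, hx.1.2 s hs]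
    rw [norm_one, ← inv_mul_cancel₀ hε.ne']
    gcongr
  obtain ⟨C, hC⟩ := isBigO_principal.mp hea
  have hq : BddHolOn (fun x : C(K, ℂ) => e x ^ 3 / (x t - w t)) (pointNhd w ε S) := by
    refine ⟨differentiableOn_pow_three_div (isOpen_pointNhd _ _ _) he.1 (hev t).1 hC, ?_⟩
    refine IsBigO.trans (g := fun x : C(K, ℂ) => (x t - w t) * (x t - w t)) ?_
      ((hev t).mul (hev t)).2
    refine isBigO_principal.mpr ⟨C ^ 3, fun x hx => ?_⟩
    simpa [pow_two] using norm_pow_three_div_le (hC x hx)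
  have hm : BddHolOn (fun x => 1 + e x + e x * e x) (pointNhd w ε S) :=
    ((BddHolOn.const 1).add he).add (he.mul he)
  refine ⟨fun x => g₁ x * (1 + e x + e x * e x), fun s x => h₁ s x * (1 + e x + e x * e x) +
    if s = t then e x ^ 3 / (x t - w t) else 0, hg₁.mul hm, fun s hs => ?_, fun x hx => ?_⟩
  · refine ((hh₁ s hs).1.mul hm).add ?_
    by_cases hst : s = t
    · simpa only [hst, if_true] using hq
    · simpa only [hst, if_false] using BddHolOn.const 0
  · have h1 : ∑ s ∈ T, (x s - w s) * (h₁ s x * (1 + e x + e x * e x) +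
        if s = t then e x ^ 3 / (x t - w t) else 0) =
        (∑ s ∈ T, (x s - w s) * h₁ s x) * (1 + e x + e x * e x) +
          (x t - w t) * (e x ^ 3 / (x t - w t)) := by
      simp only [mul_add (_ - _), Finset.sum_add_distrib, mul_ite, mul_zero, Finset.sum_ite_eq',
        htT, if_true, Finset.sum_mul]
      simp only [mul_assoc]
    have h2 : (x t - w t) * (e x ^ 3 / (x t - w t)) = e x ^ 3 := by
      by_cases ha : x t - w t = 0
      · have : e x = 0 := norm_le_zero_iff.mp (by simpa [ha] using hC x hx)
        simp [this]
      · field_simp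
    have h3 : f x * g₁ x + ∑ s ∈ T, (x s - w s) * h₁ s x = 1 - e x := by simp [e]
    rw [h1, h2]
    linear_combination (1 + e x + e x * e x) * h3

theorem hasBezoutOn_of_bounded_below [T2Space K] {w : K → ℂ} {ε δ : ℝ} (hε : 0 < ε) (hδ : 0 < δ)
    {T : Finset K} (hw : ∀ t ∈ T, ‖w t‖ ≤ 1) {f : C(K, ℂ) → ℂ}
    (hf : BddHolOn f (Metric.ball 0 1)) (hfδ : ∀ x ∈ pointNhd w ε T, δ ≤ ‖f x‖) :
    HasBezoutOn f w T (Metric.ball 0 1) := by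
  classical
  have hball : ∀ S, pointNhd w ε S ⊆ Metric.ball 0 1 := fun S x hx => by simpa using hx.1
  have key : ∀ S : Finset K, S ⊆ T → HasBezoutOn f w T (pointNhd w ε S) →
      HasBezoutOn f w T (pointNhd w ε ∅) := by
    intro S
    induction S using Finset.induction_on with
    | empty => exact fun _ h => h
    | insert t S htS ih =>
      intro hsub h
      have htT := hsub (Finset.mem_insert_self t S)
      exact ih ((Finset.subset_insert t S).trans hsub)
        (h.of_insert hε (hw t htT) htS htT (hf.mono (hball S)))
  have hempty : pointNhd w ε ∅ = Metric.ball 0 1 := by ext x; simp [pointNhd]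
  rw [← hempty]
  have hne : ∀ x ∈ pointNhd w ε T, f x ≠ 0 := fun x hx =>
    norm_pos_iff.mp (hδ.trans_le (hfδ x hx))
  refine key T subset_rfl ⟨fun x => (f x)⁻¹, fun _ _ => 0,
    ⟨(hf.1.mono (hball T)).fun_inv hne, ?_⟩, fun _ _ => BddHolOn.const 0, fun x hx => ?_⟩
  · refine isBigO_principal.mpr ⟨δ⁻¹, fun x hx => ?_⟩
    simpa using inv_anti₀ hδ (hfδ x hx)
  · simp [hne x hx]

end PointNeighborhoods

/-! ### Density of the span of point evaluations for dispersed `K`. -/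

section PointEvaluations

variable {K : Type*} [TopologicalSpace K]

/-- Evaluation at a point, as an element of the dual of `C(K)`. -/
noncomputable def evalDual (t : K) : StrongDual ℂ C(K, ℂ) := ContinuousMap.evalCLM ℂ t

@[simp]
theorem evalDual_apply (t : K) (x : C(K, ℂ)) : evalDual t x = x t := rfl

variable [CompactSpace K]

/-- A bounded functional on `C(K)` is small on functions supported in a punctured
neighborhood of a point. -/
theorem exists_isOpen_norm_apply_le_of_apply_eq_zero (φ : StrongDual ℂ C(K, ℂ)) (t : K) {η : ℝ}
    (hη : 0 < η) :
    ∃ W : Set K, IsOpen W ∧ t ∈ W ∧ ∀ h : C(K, ℂ), (∀ k ∉ W, h k = 0) → h t = 0 →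
      ‖φ h‖ ≤ η * ‖h‖ := by
  -- This replaces regularity of the measure representing `φ`. If `h₀` nearly attains `sSup A`, a
  -- unit function `h` vanishing at `t` and living where `‖h₀ k‖ < ν` can be added to it with norm
  -- at most `1 + ν`, so `φ h` must be small.
  let A : Set ℝ := (fun h : C(K, ℂ) => (φ h).re) '' {h | ‖h‖ ≤ 1 ∧ h t = 0}
  have hAφ : ∀ a ∈ A, a ≤ ‖φ‖ := by
    rintro _ ⟨h, ⟨h1, -⟩, rfl⟩
    exact (Complex.re_le_norm _).trans (by simpa using φ.le_of_opNorm_le_of_le le_rfl h1)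
  have hA0 : A.Nonempty := ⟨_, 0, ⟨by simp, by simp⟩, rfl⟩
  have hbdd : BddAbove A := ⟨‖φ‖, hAφ⟩
  obtain ⟨_, ⟨h₀, ⟨h₀1, h₀t⟩, rfl⟩, hlt⟩ :=
    exists_lt_of_lt_csSup hA0 (sub_lt_self (sSup A) (half_pos hη))
  obtain ⟨ν, hν, hνφ⟩ : ∃ ν > 0, ν * ‖φ‖ ≤ η / 2 :=
    ⟨η / (2 * (‖φ‖ + 1)), by positivity, by
      rw [div_mul_eq_mul_div, div_le_div_iff₀ (by positivity) two_pos]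
      nlinarith [norm_nonneg φ]⟩
  have hunit : ∀ h : C(K, ℂ), ‖h‖ ≤ 1 → (∀ k ∉ {k | ‖h₀ k‖ < ν}, h k = 0) → h t = 0 →
      ‖φ h‖ ≤ η := by
    intro h h1 hW ht
    obtain ⟨θ, hθ1, hθ⟩ : ∃ θ : ℂ, ‖θ‖ = 1 ∧ ‖φ h‖ = θ * φ h := by
      exact_mod_cast RCLike.exists_norm_eq_mul_self (φ h)
    have hmem : (φ (((1 + ν : ℝ) : ℂ)⁻¹ • (h₀ + θ • h))).re ∈ A := by
      refine ⟨_, ⟨?_, by simp [h₀t, ht]⟩, rfl⟩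
      rw [norm_smul, norm_inv, Complex.norm_real, Real.norm_eq_abs, abs_of_pos (by positivity),
        inv_mul_le_iff₀ (by positivity), mul_one, ContinuousMap.norm_le _ (by positivity)]
      intro k
      rw [ContinuousMap.add_apply, ContinuousMap.smul_apply, smul_eq_mul]
      refine (norm_add_le _ _).trans ?_
      rw [norm_mul, hθ1, one_mul]
      have hk := (h.norm_coe_le_norm k).trans h1
      have h₀k := (h₀.norm_coe_le_norm k).trans h₀1
      by_cases hkW : ‖h₀ k‖ < ν
      · linarith
      · rw [hW k hkW, norm_zero]
        linarith
    have hsup := le_csSup hbdd hmem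
    have hsφ : sSup A ≤ ‖φ‖ := csSup_le hA0 hAφ
    have e : (φ (((1 + ν : ℝ) : ℂ)⁻¹ • (h₀ + θ • h))).re = (1 + ν)⁻¹ * ((φ h₀).re + ‖φ h‖) := by
      rw [map_smul, map_add, map_smul, smul_eq_mul, smul_eq_mul, ← hθ, ← Complex.ofReal_inv,
        Complex.re_ofReal_mul, Complex.add_re, Complex.ofReal_re]
    rw [e, inv_mul_le_iff₀ (by positivity)] at hsup
    nlinarith
  refine ⟨{k | ‖h₀ k‖ < ν}, isOpen_lt (by fun_prop) continuous_const, by simpa [h₀t] using hν,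
    fun h hW ht => ?_⟩
  rcases eq_or_ne h 0 with rfl | h0
  · simp
  have hn : 0 < ‖h‖ := norm_pos_iff.mpr h0
  have := hunit (((‖h‖ : ℝ) : ℂ)⁻¹ • h) (by rw [norm_smul]; simp [hn.ne'])
    (fun k hk => by simp [hW k hk]) (by simp [ht])
  rw [map_smul, norm_smul, norm_inv, Complex.norm_real, norm_norm, inv_mul_le_iff₀ hn] at this
  linarith

/-- Over a dispersed compact space, a functional on the dual of `C(K)` that vanishes at all point
evaluations is zero. -/
theorem eq_zero_of_apply_eval_eq_zero [T2Space K] (hK : IsDispersed K)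
    (Φ : StrongDual ℂ (StrongDual ℂ C(K, ℂ))) (hΦ : ∀ t, Φ (evalDual t) = 0) :
    Φ = 0 := by
  ext φ
  let m : C(K, ℂ) →L[ℂ] StrongDual ℂ C(K, ℂ) :=
    (ContinuousLinearMap.compL ℂ C(K, ℂ) C(K, ℂ) ℂ φ).comp (ContinuousLinearMap.mul ℂ C(K, ℂ))
  have hm : ∀ g h, m g h = φ (g * h) := fun g h => rfl
  let Ψ : C(K, ℂ) →L[ℂ] ℂ := Φ.comp m
  -- `m g` is the functional `φ` with density `g`. The closed ideal `J` consists of the functions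
  -- vanishing on a closed set, in effect the support of `Ψ`; that set will be shown to be perfect.
  let J : Ideal C(K, ℂ) :=
    { carrier := {g | ∀ h, Ψ (g * h) = 0}
      add_mem' := fun {a b} ha hb h => by rw [add_mul, map_add, ha h, hb h, add_zero]
      zero_mem' := fun h => by rw [zero_mul, map_zero]
      smul_mem' := fun c g hg h => by
        rw [smul_eq_mul, mul_comm c g, mul_assoc]
        exact hg _ }
  have hJ : IsClosed (J : Set C(K, ℂ)) := by
    have : (J : Set C(K, ℂ)) = ⋂ h, {g | Ψ (g * h) = 0} := by ext g; simp [J]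
    rw [this]
    exact isClosed_iInter fun h => isClosed_eq (by fun_prop) continuous_const
  have hJset := ContinuousMap.idealOfSet_ofIdeal_isClosed hJ
  have hJmem : ∀ g : C(K, ℂ), (∀ k ∉ ContinuousMap.setOfIdeal J, g k = 0) → g ∈ J := fun g hg => by
    rw [← hJset, ContinuousMap.mem_idealOfSet]
    exact fun k hk => hg k hk
  have hempty : (ContinuousMap.setOfIdeal J)ᶜ = ∅ := by
    refine hK _ ⟨(ContinuousMap.setOfIdeal_open J).isClosed_compl, ?_⟩
    rw [preperfect_iff_nhds]
    by_contra! hcon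
    obtain ⟨t, htC, U, hU, hUC⟩ := hcon
    obtain ⟨b, hbt, hb0, -⟩ := exists_bump isOpen_interior (mem_interior_iff_mem_nhds.mpr hU)
    let bc : C(K, ℂ) := ⟨fun k => (b k : ℂ), by fun_prop⟩
    suffices hbJ : bc ∈ J by
      have := ContinuousMap.notMem_setOfIdeal.mp htC hbJ
      simp [bc, hbt] at this
    intro h
    have hsmall : ∀ η > 0, ‖Ψ (bc * h)‖ ≤ ‖h t‖ * (‖Φ‖ * (η * 2)) := by
      intro η hη
      obtain ⟨W, hW, htW, hWφ⟩ := exists_isOpen_norm_apply_le_of_apply_eq_zero φ t hη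
      obtain ⟨b', hbt', hb0', hb1'⟩ := exists_bump (hW.inter isOpen_interior)
        ⟨htW, mem_interior_iff_mem_nhds.mpr hU⟩
      let bc' : C(K, ℂ) := ⟨fun k => (b' k : ℂ), by fun_prop⟩
      have hbc' : ‖bc'‖ ≤ 1 := by
        rw [ContinuousMap.norm_le _ zero_le_one]
        intro k
        simpa [bc', abs_of_nonneg (hb1' k).1] using (hb1' k).2
      -- If `t` is isolated in the support, only the value at `t` matters, so `bc` may be traded for
      -- an arbitrarily narrow bump `bc'`. Then `m bc'` is nearly a multiple of `evalDual t`, which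
      -- `Φ` annihilates.
      have hdiff : bc * h - h t • bc' ∈ J := by
        refine hJmem _ fun k hk => ?_
        by_cases hkt : k = t
        · subst hkt
          simp [bc, bc', hbt, hbt']
        · have hkU : k ∉ interior U := fun h' => hkt (hUC k ⟨interior_subset h', hk⟩)
          simp [bc, bc', hb0 k hkU, hb0' k fun h' => hkU h'.2]
      have heq : Ψ (bc * h) = h t * Ψ bc' := by
        have := hdiff 1
        rwa [mul_one, map_sub, map_smul, smul_eq_mul, sub_eq_zero] at this
      have hnorm : ‖m bc' - φ bc' • evalDual t‖ ≤ η * 2 := by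
        refine ContinuousLinearMap.opNorm_le_bound _ (by positivity) fun g => ?_
        have e : (m bc' - φ bc' • evalDual t) g =
            φ (bc' * g - g t • bc') := by
          rw [map_sub, map_smul]
          simp [hm, mul_comm]
        rw [e]
        refine (hWφ _ (fun k hk => ?_) ?_).trans ?_
        · simp [bc', hb0' k fun h' => hk h'.1]
        · simp [bc', hbt']
        · rw [mul_assoc]
          gcongr
          refine (norm_sub_le _ _).trans ?_
          rw [norm_smul]
          have h1 := norm_mul_le bc' g
          have h2 := g.norm_coe_le_norm t
          nlinarith [norm_nonneg g, norm_nonneg (g t), norm_nonneg bc']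
      have hΨ : Ψ bc' = Φ (m bc' - φ bc' • evalDual t) := by
        rw [map_sub, map_smul, hΦ, smul_zero, sub_zero]
        rfl
      rw [heq, norm_mul, hΨ]
      gcongr
      exact Φ.le_of_opNorm_le_of_le le_rfl hnorm
    have hlim : Tendsto (fun η : ℝ => ‖h t‖ * (‖Φ‖ * (η * 2))) (𝓝[>] 0) (𝓝 0) := by
      have : Continuous fun η : ℝ => ‖h t‖ * (‖Φ‖ * (η * 2)) := by fun_prop
      simpa using (this.tendsto 0).mono_left nhdsWithin_le_nhds
    exact norm_le_zero_iff.mp (ge_of_tendsto hlim (by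
      filter_upwards [self_mem_nhdsWithin] with η hη using hsmall η hη))
  have h1 : (1 : C(K, ℂ)) ∈ J := hJmem 1 fun k hk => by
    have : k ∈ (ContinuousMap.setOfIdeal J)ᶜ := hk
    simp [hempty] at this
  have := h1 1
  have e : m 1 = φ := by ext g; simp [hm]
  simpa [Ψ, e] using this

/-- Hahn–Banach, applied in the quotient by the closed span. -/
theorem topologicalClosure_span_eq_top_of_dual_eq_zero {E : Type*} [NormedAddCommGroup E]
    [NormedSpace ℂ E] {s : Set E} (h : ∀ Φ : StrongDual ℂ E, (∀ v ∈ s, Φ v = 0) → Φ = 0) :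
    (Submodule.span ℂ s).topologicalClosure = ⊤ := by
  refine eq_top_iff.mpr fun v _ => ?_
  by_contra hv
  set L := (Submodule.span ℂ s).topologicalClosure
  have : IsClosed (L : Set E) := Submodule.isClosed_topologicalClosure _
  have hq : L.mkQL v ≠ 0 := by simpa using hv
  obtain ⟨q, hq⟩ := SeparatingDual.exists_ne_zero (R := ℂ) hq
  have h0 := h (q.comp L.mkQL) fun u hu => by
    rw [ContinuousLinearMap.comp_apply, Submodule.mkQL_apply, Submodule.mkQ_apply,
      (Submodule.Quotient.mk_eq_zero L).mpr
        (Submodule.le_topologicalClosure _ (Submodule.subset_span hu)), map_zero]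
  exact hq (congrArg (fun Φ => Φ v) h0)

theorem topologicalClosure_span_evalDual [T2Space K] (hK : IsDispersed K) :
    (Submodule.span ℂ (Set.range (evalDual (K := K)))).topologicalClosure = ⊤ :=
  topologicalClosure_span_eq_top_of_dual_eq_zero (E := StrongDual ℂ C(K, ℂ)) fun Φ hΦ =>
    eq_zero_of_apply_eval_eq_zero hK Φ fun t => hΦ _ ⟨t, rfl⟩

end PointEvaluations

/-! ### Cluster sets and fibers. -/

section ClusterSet

variable {X : Type*} [NormedAddCommGroup X] [NormedSpace ℂ X]

theorem HInf.norm_apply_le (h : HInf X) (b : UnitBall X) :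
    ‖(h : UnitBall X →ᵇ ℂ) b‖ ≤ ‖(h : UnitBall X →ᵇ ℂ)‖ :=
  (h : UnitBall X →ᵇ ℂ).norm_coe_le_norm b

theorem clusterSet_subset_image_fiber (f : HInf X) (x : StrongDual ℂ (StrongDual ℂ X)) :
    clusterSet f x ⊆ WeakDual.gelfandTransform ℂ (HInf X) f '' fiber x := by
  rintro z ⟨l, hl, hlx, hlz⟩
  let 𝒰 := Ultrafilter.of l
  have h𝒰 : ↑𝒰 ≤ l := Ultrafilter.of_le l
  choose τ hτle hτ using fun h : HInf X => 𝒰.exists_tendsto_of_norm_le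
    (a := fun b => (h : UnitBall X →ᵇ ℂ) b) (M := ‖(h : UnitBall X →ᵇ ℂ)‖)
    (Eventually.of_forall (HInf.norm_apply_le h))
  let T : StrongDual ℂ (HInf X) := LinearMap.mkContinuous
    { toFun := τ
      map_add' := fun g h => tendsto_nhds_unique (hτ (g + h)) ((hτ g).add (hτ h))
      map_smul' := fun c g => tendsto_nhds_unique (hτ (c • g)) ((hτ g).const_smul c) } 1
    (fun h => (hτle h).trans_eq (one_mul _).symm)
  have hT : ∀ h, T h = τ h := fun h => rfl
  have hone : τ 1 = 1 := tendsto_nhds_unique (hτ 1) tendsto_const_nhds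
  refine ⟨⟨StrongDual.toWeakDual T, fun h0 => ?_, fun g h => ?_⟩, ?_, ?_⟩
  · have := congrArg (fun φ : WeakDual ℂ (HInf X) => φ 1) h0
    exact one_ne_zero (hone.symm.trans this)
  · exact tendsto_nhds_unique (hτ (g * h)) ((hτ g).mul (hτ h))
  · refine ContinuousLinearMap.ext fun φ => ?_
    have h1 := ((WeakDual.eval_continuous φ).tendsto _).comp hlx
    exact tendsto_nhds_unique (hτ (restrictFun φ)) (h1.mono_left h𝒰)
  · exact tendsto_nhds_unique (hτ f) (hlz.mono_left h𝒰)

theorem BddHolOn.exists_hInf {g : X → ℂ} (hg : BddHolOn g (UnitBall X)) :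
    ∃ h : HInf X, ∀ b : UnitBall X, (h : UnitBall X →ᵇ ℂ) b = g b := by
  obtain ⟨M, -, hM⟩ := hg.exists_bound
  exact ⟨⟨BoundedContinuousFunction.ofNormedAddCommGroup (fun b : UnitBall X => g b)
    (continuousOn_iff_continuous_domRestrict.mp hg.1.continuousOn) M fun b => hM b b.2,
    g, hg.1, fun _ => rfl⟩, fun _ => rfl⟩

theorem HInf.exists_bddHolOn (f : HInf X) :
    ∃ F : X → ℂ, BddHolOn F (UnitBall X) ∧ ∀ b : UnitBall X, F b = (f : UnitBall X →ᵇ ℂ) b := by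
  obtain ⟨F, hF, hFf⟩ := f.2
  refine ⟨F, ⟨hF, Asymptotics.isBigO_principal.mpr ⟨‖(f : UnitBall X →ᵇ ℂ)‖, fun x hx => ?_⟩⟩, hFf⟩
  rw [hFf ⟨x, hx⟩, norm_one, mul_one]
  exact HInf.norm_apply_le f ⟨x, hx⟩

variable {K : Type*} [TopologicalSpace K] [CompactSpace K] [T2Space K]

/-- Otherwise `f - τ f` and the functions `y s - x (evalDual s)` would satisfy a Bezout identity in
`H^∞(B)`, although `τ` vanishes on all of them. No dispersedness enters here. -/
theorem exists_norm_sub_lt_of_mem_fiber {f : HInf C(K, ℂ)}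
    {x : StrongDual ℂ (StrongDual ℂ C(K, ℂ))} (hx : ‖x‖ ≤ 1)
    {τ : WeakDual.characterSpace ℂ (HInf C(K, ℂ))} (hτ : τ ∈ fiber x) (T : Finset K) {ε δ : ℝ}
    (hε : 0 < ε) (hδ : 0 < δ) :
    ∃ b : UnitBall C(K, ℂ), (∀ t ∈ T, ‖(b : C(K, ℂ)) t - x (evalDual t)‖ < ε) ∧
      ‖(f : UnitBall C(K, ℂ) →ᵇ ℂ) b - τ f‖ < δ := by
  by_contra! hcon
  obtain ⟨F, hF, hFf⟩ := HInf.exists_bddHolOn f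
  have hw : ∀ t : K, ‖x (evalDual t)‖ ≤ 1 := fun t => by
    refine (x.le_of_opNorm_le_of_le hx (b := 1) ?_).trans (by norm_num)
    refine ContinuousLinearMap.opNorm_le_bound _ zero_le_one fun y => ?_
    simpa using y.norm_coe_le_norm t
  obtain ⟨g, h, hg, hh, heq⟩ := hasBezoutOn_of_bounded_below hε hδ (T := T)
    (w := fun t => x (evalDual t)) (fun t _ => hw t) (hF.sub (BddHolOn.const (τ f)))
    (fun y hy => by
      have hyB : y ∈ UnitBall C(K, ℂ) := by simpa using hy.1
      simpa [hFf ⟨y, hyB⟩] using hcon ⟨y, hyB⟩ hy.2)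
  obtain ⟨g', hg'⟩ := hg.exists_hInf
  have hh' : ∀ s, ∃ h' : HInf C(K, ℂ), s ∈ T → ∀ b : UnitBall C(K, ℂ),
      (h' : UnitBall C(K, ℂ) →ᵇ ℂ) b = h s b := fun s => by
    by_cases hs : s ∈ T
    · obtain ⟨h', hh'⟩ := (hh s hs).exists_hInf
      exact ⟨h', fun _ => hh'⟩
    · exact ⟨0, fun h => absurd h hs⟩
  choose h' hh' using hh'
  have hid : (f - algebraMap ℂ _ (τ f)) * g' + ∑ s ∈ T, (restrictFun (evalDual s) -
      algebraMap ℂ _ (x (evalDual s))) * h' s = 1 := by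
    refine Subtype.ext (BoundedContinuousFunction.ext fun b => ?_)
    have hsum : ((∑ s ∈ T, (restrictFun (evalDual s) -
        algebraMap ℂ (HInf C(K, ℂ)) (x (evalDual s))) * h' s : HInf C(K, ℂ)) :
          UnitBall C(K, ℂ) →ᵇ ℂ) b = ∑ s ∈ T, ((b : C(K, ℂ)) s - x (evalDual s)) * h s b := by
      rw [AddSubmonoidClass.coe_finsetSum, BoundedContinuousFunction.sum_apply]
      refine Finset.sum_congr rfl fun s hs => ?_
      rw [← hh' s hs b]
      rfl
    refine Eq.trans ?_ (heq b b.2)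
    refine congrArg₂ (· + ·) ?_ hsum
    change ((f : UnitBall C(K, ℂ) →ᵇ ℂ) b - τ f) * (g' : UnitBall C(K, ℂ) →ᵇ ℂ) b =
      (F b - τ f) * g b
    rw [hFf b, hg' b]
  have hτ1 : ∀ s, τ (restrictFun (evalDual s)) =
      x (evalDual s) := fun s =>
    congrArg (fun Φ : StrongDual ℂ (StrongDual ℂ C(K, ℂ)) => Φ (evalDual s)) hτ
  have := congrArg τ hid
  simp [hτ1, AlgHomClass.commutes] at this

theorem image_fiber_subset_clusterSet (hK : IsDispersed K) (f : HInf C(K, ℂ))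
    {x : StrongDual ℂ (StrongDual ℂ C(K, ℂ))} (hx : ‖x‖ ≤ 1) :
    WeakDual.gelfandTransform ℂ (HInf C(K, ℂ)) f '' fiber x ⊆ clusterSet f x := by
  rintro _ ⟨τ, hτ, rfl⟩
  let w : K → ℂ := fun t => x (evalDual t)
  -- The coarsest filter along which the point values tend to `w` and `f` to `τ f`; the finite
  -- approximation lemma says precisely that it is proper.
  let l : Filter (UnitBall C(K, ℂ)) :=
    comap (fun b t => (b : C(K, ℂ)) t) (𝓝 w) ⊓ comap (f : UnitBall C(K, ℂ) →ᵇ ℂ) (𝓝 (τ f))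
  have hlf : Tendsto (f : UnitBall C(K, ℂ) →ᵇ ℂ) l (𝓝 (τ f)) :=
    tendsto_comap.mono_left inf_le_right
  have hlw : ∀ t, Tendsto (fun b : UnitBall C(K, ℂ) => (b : C(K, ℂ)) t) l
      (𝓝 (x (evalDual t))) := fun t =>
    ((continuous_apply t).tendsto w).comp (tendsto_comap.mono_left inf_le_left)
  refine ⟨l, ?_, ?_, hlf⟩
  · have hbasis := ((hasBasis_pi fun t => Metric.nhds_basis_ball (x := w t)).comap
      (fun (b : UnitBall C(K, ℂ)) t => (b : C(K, ℂ)) t)).inf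
      ((Metric.nhds_basis_ball (x := τ f)).comap (f : UnitBall C(K, ℂ) →ᵇ ℂ))
    rw [← nhds_pi] at hbasis
    refine hbasis.neBot_iff.mpr ?_
    rintro ⟨⟨I, r⟩, δ⟩ ⟨⟨hI, hr⟩, hδ⟩
    obtain ⟨ε, hεr, hε⟩ : ∃ ε : ℝ, (∀ t ∈ hI.toFinset, ε < r t) ∧ 0 < ε :=
      (((eventually_all_finset _).mpr fun t ht => (eventually_lt_nhds
        (hr t (by simpa using ht))).filter_mono nhdsWithin_le_nhds).and
          (self_mem_nhdsWithin (a := (0 : ℝ)) (s := Set.Ioi 0))).exists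
    obtain ⟨b, hb, hbf⟩ := exists_norm_sub_lt_of_mem_fiber (f := f) hx hτ hI.toFinset hε hδ
    refine ⟨b, fun t ht => ?_, mem_ball_iff_norm.mpr hbf⟩
    have ht' := hI.mem_toFinset.mpr ht
    exact mem_ball_iff_norm.mpr ((hb t ht').trans (hεr t ht'))
  · rw [tendsto_iff_forall_eval_tendsto_topDualPairing]
    intro φ
    change Tendsto (fun b : UnitBall C(K, ℂ) => φ b) l (𝓝 (x φ))
    have hspan : ∀ ψ ∈ Submodule.span ℂ (Set.range (evalDual (K := K))),
        Tendsto (fun b : UnitBall C(K, ℂ) => ψ b) l (𝓝 (x ψ)) := fun ψ hψ => by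
      induction hψ using Submodule.span_induction with
      | mem ψ h =>
        obtain ⟨t, rfl⟩ := h
        exact hlw t
      | zero => simpa using tendsto_const_nhds
      | add ψ₁ ψ₂ _ _ h₁ h₂ => simpa using h₁.add h₂
      | smul c ψ _ h => simpa using h.const_mul c
    rw [Metric.tendsto_nhds]
    intro η hη
    -- Only here is `K` required to be dispersed: norm approximation of `φ` by combinations of
    -- evaluations is uniform over the ball and at `x`.
    have hφ : φ ∈ (Submodule.span ℂ (Set.range (evalDual (K := K)))).topologicalClosure := by
      rw [topologicalClosure_span_evalDual hK]
      exact Submodule.mem_top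
    obtain ⟨ψ, hψ, hφψ⟩ := Metric.mem_closure_iff.mp hφ (η / 3) (by positivity)
    rw [dist_eq_norm] at hφψ
    filter_upwards [Metric.tendsto_nhds.mp (hspan ψ hψ) (η / 3) (by positivity)] with b hb
    rw [dist_eq_norm] at hb ⊢
    have h1 : ‖(φ - ψ) b‖ ≤ η / 3 := by
      simpa using (φ - ψ).le_of_opNorm_le_of_le hφψ.le (mem_ball_zero_iff.mp b.2).le
    have h2 : ‖x (φ - ψ)‖ < η / 3 := by
      have := x.le_of_opNorm_le hx (φ - ψ)
      rw [one_mul] at this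
      exact this.trans_lt hφψ
    calc ‖φ b - x φ‖ = ‖(φ - ψ) b + (ψ b - x ψ) - x (φ - ψ)‖ := by
          congr 1; rw [map_sub, _root_.sub_apply]; ring
      _ ≤ ‖(φ - ψ) b‖ + ‖ψ b - x ψ‖ + ‖x (φ - ψ)‖ :=
        (norm_sub_le _ _).trans (by gcongr; exact norm_add_le _ _)
      _ < η := by linarith

end ClusterSet

theorem theorem1 (K : Type*) [TopologicalSpace K] [CompactSpace K] [T2Space K]
    (hK : IsDispersed K) (x : StrongDual ℂ (StrongDual ℂ C(K, ℂ)))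
    (hx : x ∈ Metric.closedBall (0 : StrongDual ℂ (StrongDual ℂ C(K, ℂ))) 1)
    (f : HInf C(K, ℂ)) :
    clusterSet f x = WeakDual.gelfandTransform ℂ (HInf C(K, ℂ)) f '' fiber x :=
  (clusterSet_subset_image_fiber f x).antisymm
    (image_fiber_subset_clusterSet hK f ((dist_zero_right x).symm.trans_le hx))
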